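/- **Theorem (Quantum complexity of estimating the option price from independent marginals).** *Setting.* Let $N\ge 1$, $\epsilon_c,\varrho_c\in(0,1)$. Let $c:[0,1]^N\to[0,\infty)$ be the density of a copula (a probability density with uniform one-dimensional marginals) whose first partial derivatives exist on $[0,1]^N$ (one-sided on the boundary) and satisfy $|\partial_{u_i}c|\le c'_{\max}$ for all $i$; let $c_{\max}=\max_{[0,1]^N}c$. Let $\mathbf X=(X_1,\dots,X_N)$ be a random vector whose coordinates have densities $f_i$ and distribution functions $F_i$ and whose copula has density $c$, i.e. $\mathbb P(X_1\le x_1,\dots,X_N\le x_N)=\int_{[0,F_1(x_1)]\times\cdots\times[0,F_N(x_N)]}c(u)\,du$. Let $h:\mathbb R^N\to[0,1]$ be measurable. Put $\epsilon_i=\epsilon_c/(2Nc'_{\max})$. For intervals $[a_i,b_i]$ with $a_i<b_i$ let $\gamma_0=(b_i-a_i)^{-1/2}$, $\gamma_k(x)=\sqrt{2/(b_i-a_i)}\cos\frac{k\pi(x-a_i)}{b_i-a_i}$ ($k\ge1$) be the cosine basis of $L^2([a_i,b_i])$, extended by $0$ outside $[a_i,b_i]$, and let $f_i^{\mathcal K}=\sum_{k<\mathcal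 K}\big(\int_{a_i}^{b_i}f_i\gamma_k\big)\gamma_k$. *Assumptions on the marginals.* For every $i$: (1) either (algebraic case) there are an integer $m_i\ge1$ and a real $\zeta_i$ with $\sup_{[a_i,b_i]}|f_i^{\mathcal K}-f_i|\le\zeta_i\mathcal K^{-m_i}$ for all $\mathcal K\ge1$, and $\mathcal K_i=\max\{1,\lceil(4\zeta_i(b_i-a_i)/\epsilon_i)^{1/m_i}\rceil\}$; or (exponential case) there are $\nu_i>0$ and a real $\zeta_i$ with $\sup_{[a_i,b_i]}|f_i^{\mathcal K}-f_i|\le\zeta_ie^{-\nu_i\mathcal K}$ for all $\mathcal K\ge1$, and $\mathcal K_i=\max\{1,\lceil\log[(4\zeta_i(b_i-a_i)/\epsilon_i)^{1/\nu_i}]\rceil\}$. (2) $F_i(a_i)\le\epsilon_i/2$ and $F_i(b_i)\ge1-\epsilon_i$. (If $c'_{\max}=0$, read $\mathcal K_i=1$ and drop (2).) *Oracles.* The $i$-th data register has the Hilbert space $L^2(\mathbb R)$. The following unitaries, their inverses and their controlled versions may be queried: $\mathcal A_{X_i}$, any unitary on the $i$-th register mapping its initial state $|0\rangle$ to the state with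 amplitude $\sqrt{f_i}$; $W_{\gamma_k}$ ($k<\mathcal K_i$, acting on register $i$), the controlled rotation $|x\rangle|0\rangle\mapsto|x\rangle(\sqrt{1-\phi(x)}|0\rangle+\sqrt{\phi(x)}|1\rangle)$ with the $[0,1]$-valued function $\phi=\gamma_k^+=\frac12+\frac12\sqrt{\frac{b_i-a_i}2}\,\gamma_k$; and $W_{\hat H}$, the controlled rotation with $\phi=\hat H$, for every function $\hat H(\mathbf x)=\frac1{c_{\max}}h(\mathbf x)\,c(\hat F_1(x_1),\dots,\hat F_N(x_N))$ in which $\hat F_i(x)$ is $0$ for $x<a_i$, $1$ for $x\ge b_i$, and $\sum_{k<\mathcal K_i}\hat a_{i,k}\int_{a_i}^x\gamma_k$ clipped to $[0,1]$ for $a_i\le x<b_i$, with arbitrary real coefficients $\hat a_{i,k}$. A quantum algorithm adaptively runs finitely many circuits made of oracle queries and of unitaries on a finite-dimensional ancilla (possibly controlled on the data registers being in their initial state $|0\cdots0\rangle$), measures the ancilla after each circuit, and finally returns a real number. Queries are counted in the worst case over the measurement outcomes, and for all $i$, $k$, $\hat H$ together. *Conclusion.* Let $I_{\max}=\max_i(b_i-a_i)$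 and $\mathcal K_{\max}=\max_i\mathcal K_i$. For every $\ell>0$ there is a constant $C$, depending only on $\ell$, such that whenever $I_{\max}\ge\ell$ there is a quantum algorithm, depending only on the numbers $N,\epsilon_c,\varrho_c,c'_{\max},c_{\max}$, the $a_i,b_i$, and the rate parameters ($\zeta_i$ with $m_i$ or $\nu_i$), but not on $f_i$, $c$, $h$ or the oracles otherwise, which with probability at least $1-\varrho_c$ outputs a number $y$ with $|y-\mathbb E[h(\mathbf X)]|\le\epsilon_c$, and which queries the $W_{\gamma_k}$ at most $$C\,\frac{N^2c'_{\max}\sqrt{I_{\max}}\,\mathcal K_{\max}^2}{\epsilon_c}\log\frac{N\mathcal K_{\max}}{\varrho_c}$$ times, the $W_{\hat H}$ at most $$C\,\frac{c_{\max}}{\epsilon_c}\log\frac1{\varrho_c}$$ times, and the $\mathcal A_{X_i}$ at most $$C\left(\frac{N^2c'_{\max}I_{\max}\mathcal K_{\max}^2}{\epsilon_c}\log\frac{N\mathcal K_{\max}}{\varrho_c}+\frac{Nc_{\max}}{\epsilon_c}\log\frac1{\varrho_c}\right)$$ times. -/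

import Mathlib

open MeasureTheory

noncomputable section

/-! ### Cosine series on an interval -/

/-- The orthonormal cosine basis of `L²([a,b])`, extended by zero outside `[a,b]`. -/
def cosBasis (a b : ℝ) (k : ℕ) (x : ℝ) : ℝ :=
  open Classical in
  if x ∈ Set.Icc a b then
    (if k = 0 then 1 / √(b - a)
      else √(2 / (b - a)) * Real.cos (k * Real.pi * (x - a) / (b - a)))
  else 0

/-- The positive version of the basis function; its values lie in `[0,1]`, and
`γ_k = √(2/(b-a)) (2 γ_k⁺ - 1)`. -/
def cosBasisPos (a b : ℝ) (k : ℕ) (x : ℝ) : ℝ :=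
  1 / 2 + 1 / 2 * √((b - a) / 2) * cosBasis a b k x

/-- The `k`-th cosine coefficient of `f` on `[a,b]`. -/
def cosCoeff (a b : ℝ) (f : ℝ → ℝ) (k : ℕ) : ℝ :=
  ∫ x in a..b, f x * cosBasis a b k x

/-- The partial sum of the cosine series with `K` terms. -/
def cosPartialSum (a b : ℝ) (f : ℝ → ℝ) (K : ℕ) (x : ℝ) : ℝ :=
  ∑ k ∈ Finset.range K, cosCoeff a b f k * cosBasis a b k x

/-- The distribution function built from (estimated) coefficients: `0` to the left of `a`, `1` from
`b` on, and in between the integrated cosine series, with values clipped to `[0,1]`. -/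
def cosCDF (a b : ℝ) {K : ℕ} (coef : Fin K → ℝ) (x : ℝ) : ℝ :=
  if x < a then 0
  else if x < b then
    max 0 (min 1 (∑ k : Fin K, coef k * ∫ t in a..x, cosBasis a b k t))
  else 1

/-- The two kinds of uniform convergence rate: algebraic of order `m`, or exponential with
rate `ν`; `ζ` is the constant in front. -/
inductive CosRate where
  | algebraic (m : ℕ) (ζ : ℝ)
  | exponential (ν : ℝ) (ζ : ℝ)

/-- The order of an algebraic rate is at least `1`, the exponent of an exponential rate positive. -/
def CosRate.Valid : CosRate → Prop
  | .algebraic m _ => 1 ≤ m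
  | .exponential ν _ => 0 < ν

/-- The error allowed for the partial sum with `K` terms. -/
def CosRate.bound : CosRate → ℕ → ℝ
  | .algebraic m ζ, K => ζ * ((K : ℝ) ^ m)⁻¹
  | .exponential ν ζ, K => ζ * Real.exp (-(ν * K))

/-- The number of terms used for an interval of length `L` and a target accuracy `tol`
(always at least one term). -/
def CosRate.terms (L tol : ℝ) : CosRate → ℕ
  | .algebraic m ζ => max 1 ⌈(4 * ζ * L / tol) ^ ((1 : ℝ) / m)⌉₊
  | .exponential ν ζ => max 1 ⌈Real.log ((4 * ζ * L / tol) ^ ((1 : ℝ) / ν))⌉₊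

/-- `f` is approximated by its cosine series, uniformly on `[a,b]`, with the rate `r`. -/
def HasCosRate (a b : ℝ) (f : ℝ → ℝ) (r : CosRate) : Prop :=
  ∀ K : ℕ, 1 ≤ K → ∀ x ∈ Set.Icc a b, |cosPartialSum a b f K x - f x| ≤ r.bound K

/-! ### Copulas and marginals -/

/-- The distribution function of the density `c` on the unit cube. -/
def copulaCDF {N : ℕ} (c : (Fin N → ℝ) → ℝ) (u : Fin N → ℝ) : ℝ :=
  ∫ v in Set.Icc 0 u, c v

/-- `c` is the density of a copula: a probability density on the unit cube all of whose
one-dimensional marginals are uniform on `[0,1]`. -/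
structure IsCopulaDensity {N : ℕ} (c : (Fin N → ℝ) → ℝ) : Prop where
  nonneg : ∀ u ∈ Set.Icc (0 : Fin N → ℝ) 1, 0 ≤ c u
  integrable : IntegrableOn c (Set.Icc 0 1)
  marginal : ∀ (i : Fin N), ∀ t ∈ Set.Icc (0 : ℝ) 1, copulaCDF c (Function.update 1 i t) = t

/-- On the closed unit cube all first partial derivatives of `c` exist (one-sided on the faces) and
are bounded by `B`. -/
def PartialsBounded {N : ℕ} (c : (Fin N → ℝ) → ℝ) (B : ℝ) : Prop :=
  ∀ u ∈ Set.Icc (0 : Fin N → ℝ) 1, ∀ i, ∃ D : ℝ,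
    HasDerivWithinAt (fun t => c (Function.update u i t)) D (Set.Icc 0 1) (u i) ∧ |D| ≤ B

/-- The distribution function of the `i`-th coordinate of a random vector with law `μ`. -/
def margCDF {N : ℕ} (μ : Measure (Fin N → ℝ)) (i : Fin N) (t : ℝ) : ℝ :=
  μ.real {x | x i ≤ t}

/-- The `i`-th coordinate of a random vector with law `μ` has the probability density `f`. -/
structure HasMargDensity {N : ℕ} (μ : Measure (Fin N → ℝ)) (i : Fin N) (f : ℝ → ℝ) : Prop where
  measurable : Measurable f
  nonneg : ∀ x, 0 ≤ f x
  law : μ.map (fun x => x i) = volume.withDensity (fun x => ENNReal.ofReal (f x))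

/-- `c` is the density of the copula of the law `μ`, in the sense of Sklar:
`F(x₁,…,x_N) = C(F₁(x₁),…,F_N(x_N))`. -/
def IsCopulaOf {N : ℕ} (c : (Fin N → ℝ) → ℝ) (μ : Measure (Fin N → ℝ)) : Prop :=
  ∀ x : Fin N → ℝ, μ.real (Set.Iic x) = copulaCDF c (fun i => margCDF μ i (x i))

/-- The adjusted payoff
`Ĥ(x) = h(x) c(F̂₁(x₁),…,F̂_N(x_N)) / c_max`, where `F̂ᵢ` is built from the coefficients `coef i`. -/
def adjustedPayoff {N : ℕ} {K : Fin N → ℕ} (a b : Fin N → ℝ) (h c : (Fin N → ℝ) → ℝ) (cmax : ℝ)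
    (coef : ∀ i, Fin (K i) → ℝ) (x : Fin N → ℝ) : ℝ :=
  1 / cmax * h x * c (fun i => cosCDF (a i) (b i) (coef i) (x i))

/-! ### Registers and oracles -/

/-- The Hilbert space of one data register, whose position observable is real-valued. -/
abbrev Reg : Type := Lp ℂ 2 (volume : Measure ℝ)

/-- The Hilbert space of `N` data registers. -/
abbrev Data (N : ℕ) : Type := Lp ℂ 2 (volume : Measure (Fin N → ℝ))

theorem memLp_tensor {N : ℕ} (g : Fin N → Reg) :
    MemLp (fun x : Fin N → ℝ => ∏ i, g i (x i)) 2 volume := by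
  have hm : AEStronglyMeasurable (fun x : Fin N → ℝ => ∏ i, g i (x i)) volume := by
    apply Measurable.aestronglyMeasurable
    exact Finset.measurable_prod _ fun i _ =>
      (Lp.stronglyMeasurable (g i)).measurable.comp (measurable_pi_apply i)
  rw [memLp_two_iff_integrable_sq_norm hm]
  have h2 : ∀ i, Integrable (fun x : ℝ => ‖g i x‖ ^ 2) volume := fun i =>
    (memLp_two_iff_integrable_sq_norm (Lp.memLp (g i)).1).1 (Lp.memLp (g i))
  have h3 := Integrable.fintype_prod (μ := fun _ : Fin N => (volume : Measure ℝ)) h2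
  simpa [norm_prod, Finset.prod_pow, volume_pi] using h3

/-- The product state `g₁ ⊗ ⋯ ⊗ g_N`. -/
def tensor {N : ℕ} (g : Fin N → Reg) : Data N := (memLp_tensor g).toLp _

/-- State preparation oracles for the densities `f i`. `oracle i` is an arbitrary unitary on the
`i`-th register that sends the initial state `|0⟩` of that register to the state with amplitude
`√(f i)`; `load i` is the same unitary as an operator on all `N` registers, acting on the `i`-th
one and as the identity on the others (this determines `load i`, product states being total). -/
structure Loaders (N : ℕ) (f : Fin N → ℝ → ℝ) where
  zero : Fin N → Reg
  oracle : Fin N → (Reg ≃ₗᵢ[ℂ] Reg)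
  prepares : ∀ i, ⇑(oracle i (zero i)) =ᵐ[volume] fun x => ((√(f i x) : ℝ) : ℂ)
  load : Fin N → (Data N ≃ₗᵢ[ℂ] Data N)
  load_tensor : ∀ i (g : Fin N → Reg),
    load i (tensor g) = tensor (Function.update g i (oracle i (g i)))

/-- All that an algorithm is run against: the initial state of the data registers, the loading
unitaries, and the functions whose controlled rotations are available. -/
structure OracleSet (N : ℕ) (K : Fin N → ℕ) where
  init : Data N
  load : Fin N → (Data N ≃ₗᵢ[ℂ] Data N)
  basisFun : ∀ i, Fin (K i) → (Fin N → ℝ) → ℝ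
  payoffFun : (∀ i, Fin (K i) → ℝ) → (Fin N → ℝ) → ℝ

/-- The oracles of the pricing problem: `A_{X_i}`, the rotations `W_{γ_k}` (for the `[0,1]`-valued
version of `γ_k` on the `i`-th interval), and the rotations `W_Ĥ`. -/
def pricingOracles {N : ℕ} {K : Fin N → ℕ} {f : Fin N → ℝ → ℝ} (A : Loaders N f)
    (a b : Fin N → ℝ) (h c : (Fin N → ℝ) → ℝ) (cmax : ℝ) : OracleSet N K where
  init := tensor A.zero
  load := A.load
  basisFun := fun i k x => cosBasisPos (a i) (b i) k (x i)
  payoffFun := fun coef x => adjustedPayoff a b h c cmax coef x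

/-! ### Circuits -/

/-- Basis labels of the ancilla: the target qubit of the rotations, and a finite work register. -/
abbrev Anc (d : ℕ) : Type := Bool × Fin (d + 1)

/-- A (pure) state of data registers and ancilla: `ψ = ∑ α, ψ α ⊗ |α⟩`. -/
abbrev QState (N d : ℕ) : Type := Anc d → Data N

/-- The elementary operations. Oracles and their inverses (`inv = true`) may be controlled: they are
applied where the work register lies in `ctl`.
* `anc V`: the unitary `V` on the ancilla.
* `ancIfZero V`: the unitary `V` on the ancilla, controlled on the data registers being in their
  initial state `|0…0⟩`.
* `load`: one query to `A_{X_i}`.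
* `rotBasis`: one query to `W_{γ_k}` on the `i`-th register.
* `rotPayoff`: one query to `W_Ĥ`, with `Ĥ` given by the coefficients `coef`. -/
inductive Gate (N : ℕ) (K : Fin N → ℕ) (d : ℕ) where
  | anc (V : Matrix.unitaryGroup (Anc d) ℂ)
  | ancIfZero (V : Matrix.unitaryGroup (Anc d) ℂ)
  | load (i : Fin N) (inv : Bool) (ctl : Finset (Fin (d + 1)))
  | rotBasis (i : Fin N) (k : Fin (K i)) (inv : Bool) (ctl : Finset (Fin (d + 1)))
  | rotPayoff (coef : ∀ i, Fin (K i) → ℝ) (inv : Bool) (ctl : Finset (Fin (d + 1)))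

open Classical in
/-- Multiplication of `ψ` by the (bounded measurable) function `g`. -/
def mulFun {N : ℕ} (g : (Fin N → ℝ) → ℝ) (ψ : Data N) : Data N :=
  if hg : MemLp (fun x => (g x : ℂ) * ψ x) 2 volume then hg.toLp _ else 0

/-- The controlled rotation
`|x⟩|0⟩ ↦ |x⟩ (√(1-φ(x)) |0⟩ + √φ(x) |1⟩)`, `|x⟩|1⟩ ↦ |x⟩ (-√φ(x) |0⟩ + √(1-φ(x)) |1⟩)`
of the target qubit, or its inverse, where the work register lies in `ctl`. -/
def applyRot {N d : ℕ} (φ : (Fin N → ℝ) → ℝ) (inv : Bool) (ctl : Finset (Fin (d + 1)))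
    (ψ : QState N d) : QState N d := fun α =>
  if α.2 ∈ ctl then
    (if α.1 = inv then
      mulFun (fun x => √(1 - φ x)) (ψ α) - mulFun (fun x => √(φ x)) (ψ (!α.1, α.2))
    else
      mulFun (fun x => √(φ x)) (ψ (!α.1, α.2)) + mulFun (fun x => √(1 - φ x)) (ψ α))
  else ψ α

/-- The action of an operation on states. -/
def Gate.apply {N d : ℕ} {K : Fin N → ℕ} (O : OracleSet N K) :
    Gate N K d → QState N d → QState N d
  | .anc V, ψ => fun α => ∑ β, (V : Matrix (Anc d) (Anc d) ℂ) α β • ψ β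
  | .ancIfZero V, ψ => fun α =>
      (ψ α - inner ℂ O.init (ψ α) • O.init)
        + ∑ β, ((V : Matrix (Anc d) (Anc d) ℂ) α β * inner ℂ O.init (ψ β)) • O.init
  | .load i inv ctl, ψ => fun α =>
      if α.2 ∈ ctl then (if inv then (O.load i).symm (ψ α) else O.load i (ψ α)) else ψ α
  | .rotBasis i k inv ctl, ψ => applyRot (O.basisFun i k) inv ctl ψ
  | .rotPayoff coef inv ctl, ψ => applyRot (O.payoffFun coef) inv ctl ψ

/-- The final state of a circuit, started with data and ancilla in their initial states. -/
def runCircuit {N d : ℕ} {K : Fin N → ℕ} (O : OracleSet N K) (gates : List (Gate N K d)) :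
    QState N d :=
  gates.foldl (fun ψ G => G.apply O ψ) (fun α => if α = (false, 0) then O.init else 0)

/-! ### Algorithms -/

/-- A quantum algorithm with classical control: it returns a number, or it runs a circuit on fresh
registers, measures the ancilla in the computational basis, and goes on depending on the outcome. -/
inductive Algorithm (N : ℕ) (K : Fin N → ℕ) where
  | ret (r : ℝ)
  | run (d : ℕ) (gates : List (Gate N K d)) (next : Anc d → Algorithm N K)

open Classical in
/-- The probability that the output lies in `S` (Born rule). -/
def Algorithm.prob {N : ℕ} {K : Fin N → ℕ} (O : OracleSet N K) (S : Set ℝ) :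
    Algorithm N K → ℝ
  | .ret r => if r ∈ S then 1 else 0
  | .run _ gates next => ∑ α, ‖runCircuit O gates α‖ ^ 2 * (next α).prob O S

/-- The worst-case number (over all measurement outcomes) of operations counted by `cnt`. -/
def Algorithm.count {N : ℕ} {K : Fin N → ℕ} (cnt : ∀ d, Gate N K d → ℕ) :
    Algorithm N K → ℕ
  | .ret _ => 0
  | .run d gates next =>
      (gates.map (cnt d)).sum + Finset.univ.sup fun α => (next α).count cnt

/-- The number of queries to the oracles `A_{X_1}, …, A_{X_N}`, all together. -/
def Algorithm.loadQueries {N : ℕ} {K : Fin N → ℕ} (P : Algorithm N K) : ℕ :=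
  P.count fun _ G => match G with
    | .load _ _ _ => 1
    | _ => 0

/-- The number of queries to the oracles `W_{γ_k}`, for all registers and all `k` together. -/
def Algorithm.basisQueries {N : ℕ} {K : Fin N → ℕ} (P : Algorithm N K) : ℕ :=
  P.count fun _ G => match G with
    | .rotBasis _ _ _ _ => 1
    | _ => 0

/-- The number of queries to the oracles `W_Ĥ`, for all `Ĥ` together. -/
def Algorithm.payoffQueries {N : ℕ} {K : Fin N → ℕ} (P : Algorithm N K) : ℕ :=
  P.count fun _ G => match G with
    | .rotPayoff _ _ _ => 1
    | _ => 0

/-! ### Parameters of the pricing problem -/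

/-- The accuracy `ε_c / (2 N c'_max)` at which the marginal distribution functions are needed. -/
def margTol (N : ℕ) (ε cd : ℝ) : ℝ := ε / (2 * N * cd)

/-- The number `𝒦_i` of cosine terms for the `i`-th marginal. -/
def numTerms {N : ℕ} (ε cd : ℝ) (a b : Fin N → ℝ) (r : Fin N → CosRate) (i : Fin N) : ℕ :=
  (r i).terms (b i - a i) (margTol N ε cd)

/-- `I_max`, the largest interval length. -/
def maxLength {N : ℕ} (a b : Fin N → ℝ) : ℝ := ⨆ i, (b i - a i)

/-- `𝒦_max`, the largest number of cosine terms. -/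
def maxTerms {N : ℕ} (K : Fin N → ℕ) : ℕ := Finset.univ.sup K

end

/-!
The price `E[h(X)]` is an amplitude. By Sklar's formula the law of `X` has the density `c(F₁(x₁),
…, F_N(x_N))` with respect to the product of its marginals (`IsCopulaOf.eq_withDensity`), and the
loading oracles prepare a state whose position has exactly that product law
(`norm_sq_loaded_all`). Hence `E[h(X)] / c_max` is, up to the error of replacing `Fᵢ` by the
rebuilt distribution function `F̂ᵢ`, the probability that a `W_Ĥ` rotation of the loaded state
flips its target qubit. As the partial derivatives of `c` are bounded by `c'_max`, knowing every
`Fᵢ` up to `εᵢ = ε_c / (2 N c'_max)` costs at most `ε_c / 2`. In turn `Fᵢ` follows from its first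
`𝒦ᵢ` cosine coefficients (`abs_cosCDF_sub_cdf_le`), each of which is an affine function of the
flip probability of a `W_{γ_k}` rotation.

Both kinds of probability are found by amplitude estimation (`exists_amplitude_estimation`).
Grover iterations, controlled on a work register with `M = (m + 1) L` labels in a superposition
`w`, put the angle `(2j + 1) θ` on the label `j`, where `sin² θ` is the probability sought; a
discrete Fourier transform then reads off `θ`. The amplitudes `w` are the normalized coefficients
of `(1 + X + ⋯ + X^(L-1))^(m+1)`. Since `(1 - z)^m` times this polynomial is `(1 - z^L)^m (1 + z +
⋯ + z^(L-1))`, Parseval's identity bounds the `2m`-th moment of the error, and Markov's inequality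
gives accuracy `η ≥ 2 / L` with failure probability at most `(m + 1) / 4^m`
(`exists_phase_window`). One run with `m` proportional to the logarithm of the inverse failure
probability therefore replaces the usual median of repeated runs.

The query bounds tend to `0` in two regimes, which are treated separately. If `N = 1` or `2 N
c'_max ≤ ε_c`, then `c(F̂₁, …, F̂_N)` is accurate enough for any `F̂ᵢ` with values in `[0,1]`, and
no coefficient is estimated. If `ϱ_c` is close to `1`, the payoff is estimated only up to `g`
times the permitted error, and one of `g` candidate values is returned at random
(`exists_payoff_estimation`): the success probability drops to about `1 / g`, which suffices for
`g` of order `1 / (1 - ϱ_c)`, and the number of queries drops by the same factor.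
-/

noncomputable section

/-! ### Phase estimation with a polynomial window -/

/-- Every unit vector is a column of some unitary matrix. -/
theorem exists_unitary_col {ι : Type*} [Fintype ι] [DecidableEq ι] (i₀ : ι) (w : ι → ℂ)
    (hw : ∑ i, ‖w i‖ ^ 2 = 1) :
    ∃ V : Matrix.unitaryGroup ι ℂ, ∀ i, (V : Matrix ι ι ℂ) i i₀ = w i := by
  have hn : ‖(WithLp.toLp 2 w : EuclideanSpace ℂ ι)‖ = 1 := by
    rw [EuclideanSpace.norm_eq]; simp [hw]
  have ho : Orthonormal ℂ (({i₀} : Set ι).domRestrict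
      (fun _ => (WithLp.toLp 2 w : EuclideanSpace ℂ ι))) := by
    rw [orthonormal_iff_ite]
    rintro ⟨i, hi⟩ ⟨j, hj⟩
    simp only [Set.mem_singleton_iff] at hi hj
    subst hi; subst hj
    simp only [Set.domRestrict_apply, if_true]
    rw [inner_self_eq_norm_sq_to_K, hn]; simp
  obtain ⟨b, hb⟩ := ho.exists_orthonormalBasis_extension_of_card_eq (by simp)
  refine ⟨⟨(EuclideanSpace.basisFun ι ℂ).toBasis.toMatrix b,
    (EuclideanSpace.basisFun ι ℂ).toMatrix_orthonormalBasis_mem_unitary b⟩, fun i => ?_⟩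
  simp [Module.Basis.toMatrix_apply, hb i₀ rfl]

theorem sum_norm_sq_unitary {ι : Type*} [Fintype ι] [DecidableEq ι]
    (V : Matrix.unitaryGroup ι ℂ) (v : ι → ℂ) :
    ∑ i, ‖∑ j, (V : Matrix ι ι ℂ) i j * v j‖ ^ 2 = ∑ i, ‖v i‖ ^ 2 := by
  have key : ∀ u : ι → ℂ, ((∑ i, ‖u i‖ ^ 2 : ℝ) : ℂ) = star u ⬝ᵥ u := by
    intro u
    simp [dotProduct, ← Complex.normSq_eq_norm_sq, Complex.normSq_eq_conj_mul_self]
  have hV : star (V : Matrix ι ι ℂ) * (V : Matrix ι ι ℂ) = 1 :=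
    Matrix.UnitaryGroup.star_mul_self V
  have : ((∑ i, ‖((V : Matrix ι ι ℂ).mulVec v) i‖ ^ 2 : ℝ) : ℂ) = ((∑ i, ‖v i‖ ^ 2 : ℝ) : ℂ) := by
    rw [key, key, Matrix.star_mulVec, Matrix.dotProduct_mulVec, Matrix.vecMul_vecMul]
    rw [← Matrix.star_eq_conjTranspose, hV, Matrix.vecMul_one]
  exact_mod_cast this

/-- The conjugate discrete Fourier transform on `d + 1` labels. -/
def fourierMatrix (d : ℕ) : Matrix (Fin (d + 1)) (Fin (d + 1)) ℂ := fun y j =>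
  ((√(d + 1 : ℝ) : ℝ) : ℂ)⁻¹ *
    (Complex.exp (-(2 * Real.pi * Complex.I / (d + 1 : ℕ))) ^ (y : ℕ)) ^ (j : ℕ)

theorem fourierMatrix_mem_unitary (d : ℕ) :
    fourierMatrix d ∈ Matrix.unitaryGroup (Fin (d + 1)) ℂ := by
  rw [Matrix.mem_unitaryGroup_iff]
  set ζ := Complex.exp (-(2 * Real.pi * Complex.I / (d + 1 : ℕ))) with hζ
  have hprim : IsPrimitiveRoot ζ (d + 1) := by
    have := (Complex.isPrimitiveRoot_exp (d + 1) (by omega)).inv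
    rwa [← Complex.exp_neg] at this
  have hnorm : ‖ζ‖ = 1 := hprim.norm'_eq_one (by omega)
  have hconj : star ζ = ζ⁻¹ := by
    rw [Complex.inv_eq_conj hnorm]; rfl
  have h0 : ζ ≠ 0 := by intro h; simp [h] at hnorm
  have hs : ((√(d + 1 : ℝ) : ℝ) : ℂ)⁻¹ * ((√(d + 1 : ℝ) : ℝ) : ℂ)⁻¹ = ((d : ℂ) + 1)⁻¹ := by
    rw [← mul_inv]
    congr 1
    rw [← Complex.ofReal_mul, Real.mul_self_sqrt (by positivity)]
    push_cast; rfl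
  ext y z
  rw [Matrix.mul_apply]
  have h1 : ∀ j : Fin (d + 1), fourierMatrix d y j * star (fourierMatrix d) j z
      = ((d : ℂ) + 1)⁻¹ * (ζ ^ (y : ℕ) * (ζ ^ (z : ℕ))⁻¹) ^ (j : ℕ) := by
    intro j
    rw [Matrix.star_apply, fourierMatrix, fourierMatrix, ← hζ, star_mul', star_inv₀, star_pow,
      star_pow, hconj]
    have : star ((√(d + 1 : ℝ) : ℝ) : ℂ) = ((√(d + 1 : ℝ) : ℝ) : ℂ) := Complex.conj_ofReal _
    rw [this, mul_pow, ← hs, inv_pow, inv_pow]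
    ring
  rw [Finset.sum_congr rfl fun j _ => h1 j, ← Finset.mul_sum,
    Fin.sum_univ_eq_sum_range (fun j => (ζ ^ (y : ℕ) * (ζ ^ (z : ℕ))⁻¹) ^ j) (d + 1)]
  by_cases hyz : y = z
  · subst hyz
    have : (d : ℂ) + 1 ≠ 0 := by exact_mod_cast Nat.succ_ne_zero d
    simp [h0, this]
  · rw [Matrix.one_apply_ne hyz]
    have hne : ζ ^ (y : ℕ) * (ζ ^ (z : ℕ))⁻¹ ≠ 1 := by
      intro h
      rw [mul_inv_eq_one₀ (pow_ne_zero _ h0)] at h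
      exact hyz (Fin.ext (hprim.pow_inj y.2 z.2 h))
    have hpow : (ζ ^ (y : ℕ) * (ζ ^ (z : ℕ))⁻¹) ^ (d + 1) = 1 := by
      have h2 : ∀ k : ℕ, (ζ ^ k) ^ (d + 1) = 1 := fun k => by
        rw [pow_right_comm, hprim.pow_eq_one, one_pow]
      rw [mul_pow, inv_pow, h2, h2]; simp
    rw [geom_sum_eq hne, hpow]; simp

open Polynomial in
/-- Parseval's identity at the roots of unity shifted by `u`. -/
theorem sum_norm_sq_eval_roots (d : ℕ) (P : ℂ[X]) (u : ℂ)
    (hu : ‖u‖ = 1) :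
    ∑ y : Fin (d + 1), ‖∑ j : Fin (d + 1), fourierMatrix d y j * (P.coeff j * u ^ (j : ℕ))‖ ^ 2
      = ∑ j : Fin (d + 1), ‖P.coeff j‖ ^ 2 := by
  have := sum_norm_sq_unitary ⟨fourierMatrix d, fourierMatrix_mem_unitary d⟩
    (fun j : Fin (d + 1) => P.coeff j * u ^ (j : ℕ))
  simpa [hu] using this

open Polynomial in
theorem sum_fourierMatrix_mul_coeff (d : ℕ) (P : ℂ[X]) (hP : P.natDegree < d + 1) (u : ℂ)
    (y : Fin (d + 1)) :
    ∑ j : Fin (d + 1), fourierMatrix d y j * (P.coeff j * u ^ (j : ℕ)) =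
      ((√(d + 1 : ℝ) : ℝ) : ℂ)⁻¹ *
        P.eval (u * Complex.exp (-(2 * Real.pi * Complex.I / (d + 1 : ℕ))) ^ (y : ℕ)) := by
  rw [Polynomial.eval_eq_sum_range' hP, Finset.mul_sum,
    ← Fin.sum_univ_eq_sum_range (fun j => ((√(d + 1 : ℝ) : ℝ) : ℂ)⁻¹ * (P.coeff j *
      (u * Complex.exp (-(2 * Real.pi * Complex.I / (d + 1 : ℕ))) ^ (y : ℕ)) ^ j))]
  refine Finset.sum_congr rfl fun j _ => ?_
  rw [fourierMatrix, mul_pow]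
  ring

theorem abs_sin_sq_sub_sin_sq_le (x y : ℝ) :
    |Real.sin x ^ 2 - Real.sin y ^ 2| ≤ |Real.sin (x - y)| := by
  have h : Real.sin x ^ 2 - Real.sin y ^ 2 = Real.sin (x + y) * Real.sin (x - y) := by
    rw [Real.sin_add, Real.sin_sub]
    have h1 := Real.sin_sq_add_cos_sq x
    have h2 := Real.sin_sq_add_cos_sq y
    linear_combination Real.sin y ^ 2 * h1 - Real.sin x ^ 2 * h2
  rw [h, abs_mul]
  have := Real.abs_sin_le_one (x + y)
  nlinarith [abs_nonneg (Real.sin (x - y))]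

theorem norm_one_sub_exp (x : ℝ) : ‖1 - Complex.exp (2 * x * Complex.I)‖ = 2 * |Real.sin x| := by
  have h := Complex.norm_exp_I_mul_ofReal_sub_one (2 * x)
  rw [norm_sub_rev]
  have e : (2 * x * Complex.I : ℂ) = Complex.I * ((2 * x : ℝ) : ℂ) := by push_cast; ring
  rw [e, h, mul_div_cancel_left₀ _ two_ne_zero, norm_mul]
  simp

open Polynomial in
/-- The phase-estimation window with generating polynomial `(1 + X + ⋯ + X^(L-1))^(m+1)`:
multiplying by `(1 - z)^m` turns it into `(1 - z^L)^m (1 + z + ⋯ + z^(L-1))`, whose values at the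
shifted roots of unity are controlled by Parseval's identity. -/
theorem sum_pow_mul_window_le (L m d : ℕ) (hL : 1 ≤ L) (hd : d + 1 = (m + 1) * L) (u : ℂ)
    (hu : ‖u‖ = 1) :
    ∑ y : Fin (d + 1),
      ‖1 - u * Complex.exp (-(2 * Real.pi * Complex.I / (d + 1 : ℕ))) ^ (y : ℕ)‖ ^ (2 * m) *
        ‖∑ j : Fin (d + 1), fourierMatrix d y j *
          (((∑ k ∈ Finset.range L, (X : ℂ[X]) ^ k) ^ (m + 1)).coeff j * u ^ (j : ℕ))‖ ^ 2
      ≤ 4 ^ m * L := by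
  set ζ := Complex.exp (-(2 * Real.pi * Complex.I / (d + 1 : ℕ))) with hζ
  have hζn : ‖ζ‖ = 1 := by
    rw [hζ, Complex.norm_exp]; simp [Complex.div_re]
  set B : ℂ[X] := ∑ k ∈ Finset.range L, (X : ℂ[X]) ^ k with hB
  have hBdeg : B.natDegree ≤ L - 1 := by
    refine natDegree_sum_le_of_forall_le _ _ fun k hk => ?_
    rw [natDegree_X_pow]
    have := Finset.mem_range.1 hk; omega
  have hL1 : L - 1 < d + 1 := by rw [hd]; nlinarith [Nat.sub_lt hL one_pos]
  have hWdeg : (B ^ (m + 1)).natDegree < d + 1 := by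
    refine (natDegree_pow_le_of_le (m + 1) hBdeg).trans_lt ?_
    rw [hd]
    exact Nat.mul_lt_mul_of_pos_left (by omega) (by omega)
  have hBd : B.natDegree < d + 1 := hBdeg.trans_lt hL1
  have hBcoeff : ∑ j : Fin (d + 1), ‖B.coeff j‖ ^ 2 = L := by
    rw [Fin.sum_univ_eq_sum_range (fun j => ‖B.coeff j‖ ^ 2) (d + 1)]
    have : ∀ j, ‖B.coeff j‖ ^ 2 = if j ∈ Finset.range L then (1 : ℝ) else 0 := by
      intro j
      simp only [hB, finsetSum_coeff, coeff_X_pow, Finset.sum_ite_eq]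
      split_ifs <;> simp
    rw [Finset.sum_congr rfl fun j _ => this j, Finset.sum_ite_mem]
    have : Finset.range (d + 1) ∩ Finset.range L = Finset.range L := by
      rw [Finset.inter_eq_right]; exact Finset.range_subset_range.2 (by omega)
    rw [this]; simp
  rw [← hBcoeff, ← sum_norm_sq_eval_roots d B u hu, Finset.mul_sum]
  refine Finset.sum_le_sum fun y _ => ?_
  rw [sum_fourierMatrix_mul_coeff d _ hWdeg, sum_fourierMatrix_mul_coeff d _ hBd, ← hζ]
  set z := u * ζ ^ (y : ℕ) with hz
  have hzn : ‖z‖ = 1 := by simp [hz, hu, hζn]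
  have e1 : (1 - z) * B.eval z = 1 - z ^ L := by
    have := mul_geom_sum z L
    simp only [hB, eval_finsetSum, eval_pow, eval_X]
    linear_combination -this
  have e2 : ‖1 - z ^ L‖ ≤ 2 := by
    calc ‖1 - z ^ L‖ ≤ ‖(1 : ℂ)‖ + ‖z ^ L‖ := norm_sub_le _ _
      _ = 2 := by simp [hzn]; norm_num
  have e3 : ‖1 - z‖ ^ (2 * m) * ‖((√(d + 1 : ℝ) : ℝ) : ℂ)⁻¹ * (B ^ (m + 1)).eval z‖ ^ 2
      = ‖1 - z ^ L‖ ^ (2 * m) * ‖((√(d + 1 : ℝ) : ℝ) : ℂ)⁻¹ * B.eval z‖ ^ 2 := by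
    rw [← e1]
    simp only [norm_mul, eval_pow, norm_pow]
    ring
  rw [e3]
  refine mul_le_mul_of_nonneg_right ?_ (by positivity)
  calc ‖1 - z ^ L‖ ^ (2 * m) ≤ 2 ^ (2 * m) := pow_le_pow_left₀ (norm_nonneg _) e2 _
    _ = 4 ^ m := by rw [pow_mul]; norm_num

theorem norm_sq_add_norm_sq_eq (a b : ℂ) :
    ‖a‖ ^ 2 + ‖b‖ ^ 2 = (‖b + Complex.I * a‖ ^ 2 + ‖b - Complex.I * a‖ ^ 2) / 2 := by
  simp only [← Complex.normSq_eq_norm_sq, Complex.normSq_apply]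
  simp
  ring

/-- The value of `sin² θ` read off from the label `y` when phases are resolved to multiples of
`π / (d + 1)`. -/
def phaseValue (d : ℕ) (y : Fin (d + 1)) : ℝ :=
  Real.sin (Real.pi * ((y : ℕ) : ℝ) / ((d + 1 : ℕ) : ℝ)) ^ 2

open Polynomial in
/-- Phase estimation with accuracy `1 / L` and exponentially small failure probability: for a
suitable window `w` on `(m + 1) L` labels, the Fourier transform of the amplitudes `w j
sin((2j+1)θ)` and `w j cos((2j+1)θ)` is concentrated on those `y` for which `sin²(πy/M)` is close
to `sin² θ`. -/
theorem exists_phase_window (L m : ℕ) (hL : 1 ≤ L) :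
    ∃ (d : ℕ) (w : Fin (d + 1) → ℂ), d + 1 = (m + 1) * L ∧ ∑ j, ‖w j‖ ^ 2 = 1 ∧
      ∀ θ η : ℝ, 0 < η →
        ∑ y : Fin (d + 1) with η < |phaseValue d y - Real.sin θ ^ 2|,
          (‖∑ j : Fin (d + 1), fourierMatrix d y j *
              (w j * (Real.sin ((2 * (j : ℕ) + 1) * θ) : ℝ))‖ ^ 2
          + ‖∑ j : Fin (d + 1), fourierMatrix d y j *
              (w j * (Real.cos ((2 * (j : ℕ) + 1) * θ) : ℝ))‖ ^ 2)
        ≤ (m + 1) / (L * η) ^ (2 * m) := by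
  obtain ⟨d, hd⟩ : ∃ d, d + 1 = (m + 1) * L :=
    ⟨(m + 1) * L - 1, Nat.sub_add_cancel (Nat.mul_pos (by omega) hL)⟩
  have hLpos : (0 : ℝ) < L := by exact_mod_cast hL
  set W : ℂ[X] := (∑ k ∈ Finset.range L, (X : ℂ[X]) ^ k) ^ (m + 1) with hW
  set S : ℝ := ∑ j : Fin (d + 1), ‖W.coeff j‖ ^ 2 with hS
  have hWdeg : W.natDegree < d + 1 := by
    have hBdeg : (∑ k ∈ Finset.range L, (X : ℂ[X]) ^ k).natDegree ≤ L - 1 := by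
      refine natDegree_sum_le_of_forall_le _ _ fun k hk => ?_
      rw [natDegree_X_pow]
      have := Finset.mem_range.1 hk; omega
    refine (natDegree_pow_le_of_le (m + 1) hBdeg).trans_lt ?_
    rw [hd]
    exact Nat.mul_lt_mul_of_pos_left (by omega) (by omega)
  -- Cauchy-Schwarz: the squared norm of the window is at least `W(1)² / (d + 1)`.
  have hSge : (L : ℝ) ^ (2 * m + 1) / (m + 1) ≤ S := by
    have h1 : ‖W.eval 1‖ = (L : ℝ) ^ (m + 1) := by
      simp [hW, eval_finsetSum]
    have h2 : ‖W.eval 1‖ ≤ ∑ j : Fin (d + 1), ‖W.coeff j‖ := by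
      rw [Polynomial.eval_eq_sum_range' hWdeg]
      simp only [one_pow, mul_one]
      rw [Fin.sum_univ_eq_sum_range (fun j => ‖W.coeff j‖) (d + 1)]
      exact norm_sum_le _ _
    have h3 := sq_sum_le_card_mul_sum_sq (s := (Finset.univ : Finset (Fin (d + 1))))
      (f := fun j => ‖W.coeff j‖)
    rw [Finset.card_univ, Fintype.card_fin, ← hS] at h3
    rw [h1] at h2
    have h4 : ((L : ℝ) ^ (m + 1)) ^ 2 ≤ ((d + 1 : ℕ) : ℝ) * S :=
      (pow_le_pow_left₀ (by positivity) h2 2).trans h3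
    rw [hd] at h4
    push_cast at h4
    rw [div_le_iff₀ (by positivity)]
    refine le_of_mul_le_mul_right ?_ hLpos
    calc (L : ℝ) ^ (2 * m + 1) * L = ((L : ℝ) ^ (m + 1)) ^ 2 := by ring
      _ ≤ _ := h4
      _ = _ := by ring
  have hSpos : 0 < S := lt_of_lt_of_le (by positivity) hSge
  have hsS : √S ^ 2 = S := Real.sq_sqrt hSpos.le
  refine ⟨d, fun j => ((√S : ℝ) : ℂ)⁻¹ * W.coeff j, hd, ?_, ?_⟩
  · simp only [norm_mul, norm_inv, Complex.norm_real, Real.norm_eq_abs, mul_pow, inv_pow, sq_abs,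
      hsS]
    rw [← Finset.mul_sum, ← hS, inv_mul_cancel₀ hSpos.ne']
  intro θ η hη
  set M : ℝ := ((d + 1 : ℕ) : ℝ) with hM
  have hMpos : 0 < M := by rw [hM]; positivity
  set ζ := Complex.exp (-(2 * Real.pi * Complex.I / (d + 1 : ℕ))) with hζ
  set s : Fin (d + 1) → ℂ := fun y => ∑ j : Fin (d + 1), fourierMatrix d y j *
    (((√S : ℝ) : ℂ)⁻¹ * W.coeff j * (Real.sin ((2 * (j : ℕ) + 1) * θ) : ℝ)) with hs
  set c : Fin (d + 1) → ℂ := fun y => ∑ j : Fin (d + 1), fourierMatrix d y j *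
    (((√S : ℝ) : ℂ)⁻¹ * W.coeff j * (Real.cos ((2 * (j : ℕ) + 1) * θ) : ℝ)) with hc
  set δ : Fin (d + 1) → ℝ := fun y =>
    |phaseValue d y - Real.sin θ ^ 2| with hδ
  have hcomb : ∀ (σ : ℝ), (σ = 1 ∨ σ = -1) → ∀ y, c y + σ * (Complex.I * s y) =
      Complex.exp (σ * θ * Complex.I) * ((√S : ℝ) : ℂ)⁻¹ *
        ∑ j : Fin (d + 1), fourierMatrix d y j *
          (W.coeff j * Complex.exp (2 * (σ * θ : ℝ) * Complex.I) ^ (j : ℕ)) := by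
    intro σ hσ y
    simp only [hc, hs, Finset.mul_sum]
    rw [← Finset.sum_add_distrib]
    refine Finset.sum_congr rfl fun j _ => ?_
    have : ((Real.cos ((2 * (j : ℕ) + 1) * θ) : ℝ) : ℂ)
        + σ * Complex.I * ((Real.sin ((2 * (j : ℕ) + 1) * θ) : ℝ) : ℂ)
        = Complex.exp (σ * θ * Complex.I) *
          Complex.exp (2 * (σ * θ : ℝ) * Complex.I) ^ (j : ℕ) := by
      rw [← Complex.exp_nat_mul, ← Complex.exp_add]
      have e : (σ * θ * Complex.I + (j : ℕ) * (2 * (σ * θ : ℝ) * Complex.I) : ℂ)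
          = ((σ * ((2 * (j : ℕ) + 1) * θ) : ℝ) : ℂ) * Complex.I := by push_cast; ring
      rw [e, Complex.exp_mul_I, ← Complex.ofReal_cos, ← Complex.ofReal_sin]
      rcases hσ with rfl | rfl
      · simp; ring
      · simp; ring
    linear_combination (fourierMatrix d y j * ((√S : ℝ) : ℂ)⁻¹ * W.coeff j) * this
  -- `e^{2iθ}` and `e^{-2iθ}` have the same `sin² θ`, so both contributions are concentrated at the
  -- correct values.
  have htail : ∀ (σ : ℝ), (σ = 1 ∨ σ = -1) →
      ∑ y, (2 * δ y) ^ (2 * m) * ‖c y + σ * (Complex.I * s y)‖ ^ 2 ≤ S⁻¹ * (4 ^ m * L) := by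
    intro σ hσ
    have hun : ‖Complex.exp (2 * (σ * θ : ℝ) * Complex.I)‖ = 1 := by
      have : (2 * (σ * θ : ℝ) * Complex.I : ℂ) = ((2 * (σ * θ) : ℝ) : ℂ) * Complex.I := by
        push_cast; ring
      rw [this, Complex.norm_exp_ofReal_mul_I]
    refine le_trans ?_ (mul_le_mul_of_nonneg_left
      (sum_pow_mul_window_le L m d hL hd (Complex.exp (2 * (σ * θ : ℝ) * Complex.I)) hun)
      (inv_nonneg.2 hSpos.le))
    rw [Finset.mul_sum]
    refine Finset.sum_le_sum fun y _ => ?_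
    rw [hcomb σ hσ, norm_mul, norm_mul]
    have e1 : ‖Complex.exp (σ * θ * Complex.I)‖ = 1 := by
      rw [← Complex.ofReal_mul, Complex.norm_exp_ofReal_mul_I]
    have e2 : ‖((√S : ℝ) : ℂ)⁻¹‖ ^ 2 = S⁻¹ := by
      rw [norm_inv, Complex.norm_real, inv_pow, Real.norm_eq_abs, sq_abs, hsS]
    have e3 : 2 * δ y ≤ ‖1 - Complex.exp (2 * (σ * θ : ℝ) * Complex.I) * ζ ^ (y : ℕ)‖ := by
      have e4 : Complex.exp (2 * (σ * θ : ℝ) * Complex.I) * ζ ^ (y : ℕ)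
          = Complex.exp (2 * ((σ * θ - Real.pi * y / (d + 1 : ℕ) : ℝ) : ℂ) * Complex.I) := by
        rw [hζ, ← Complex.exp_nat_mul, ← Complex.exp_add]
        congr 1
        push_cast; ring
      rw [e4, norm_one_sub_exp]
      refine mul_le_mul_of_nonneg_left ?_ two_pos.le
      refine le_trans (le_of_eq ?_) (abs_sin_sq_sub_sin_sq_le _ _)
      simp only [hδ, phaseValue]
      rw [abs_sub_comm]
      rcases hσ with rfl | rfl <;> simp
    rw [e1, one_mul, mul_pow ‖((√S : ℝ) : ℂ)⁻¹‖, e2, mul_left_comm]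
    refine mul_le_mul_of_nonneg_left ?_ (inv_nonneg.2 hSpos.le)
    refine mul_le_mul_of_nonneg_right ?_ (by positivity)
    exact pow_le_pow_left₀ (by positivity) e3 _
  have htot : ∑ y, (2 * δ y) ^ (2 * m) * (‖s y‖ ^ 2 + ‖c y‖ ^ 2) ≤ S⁻¹ * (4 ^ m * L) := by
    have h1 := htail 1 (Or.inl rfl)
    have h2 := htail (-1) (Or.inr rfl)
    have h3 : ∑ y, (2 * δ y) ^ (2 * m) * (‖s y‖ ^ 2 + ‖c y‖ ^ 2) =
        (∑ y, (2 * δ y) ^ (2 * m) * ‖c y + (1 : ℝ) * (Complex.I * s y)‖ ^ 2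
        + ∑ y, (2 * δ y) ^ (2 * m) * ‖c y + (-1 : ℝ) * (Complex.I * s y)‖ ^ 2) / 2 := by
      rw [← Finset.sum_add_distrib, Finset.sum_div]
      refine Finset.sum_congr rfl fun y _ => ?_
      rw [norm_sq_add_norm_sq_eq]
      push_cast
      rw [one_mul, neg_one_mul, ← sub_eq_add_neg]; ring
    rw [h3]; linarith
  -- Markov's inequality for the `2m`-th moment.
  have hmarkov : (2 * η) ^ (2 * m) * ∑ y with η < δ y, (‖s y‖ ^ 2 + ‖c y‖ ^ 2)
      ≤ S⁻¹ * (4 ^ m * L) := by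
    refine le_trans ?_ htot
    rw [Finset.mul_sum]
    refine le_trans (Finset.sum_le_sum fun y hy => ?_)
      (Finset.sum_le_sum_of_subset_of_nonneg (Finset.filter_subset (fun y => η < δ y) _)
        fun y _ _ => by positivity)
    refine mul_le_mul_of_nonneg_right ?_ (by positivity)
    have : η < δ y := (Finset.mem_filter.1 hy).2
    exact pow_le_pow_left₀ (by positivity) (by linarith) _
  have hSinv : S⁻¹ ≤ (m + 1) / (L : ℝ) ^ (2 * m + 1) := by
    rw [inv_le_comm₀ hSpos (by positivity), inv_div]
    exact hSge
  have h4 : (4 : ℝ) ^ m = 2 ^ (2 * m) := by rw [pow_mul]; norm_num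
  rw [← mul_le_mul_iff_of_pos_left (show 0 < (2 * η) ^ (2 * m) by positivity)]
  refine hmarkov.trans ((mul_le_mul_of_nonneg_right hSinv (by positivity)).trans (le_of_eq ?_))
  rw [h4, mul_pow, mul_pow, pow_succ]
  field_simp

/-! ### Multiplication operators -/

theorem memLp_mulFun {N : ℕ} {g : (Fin N → ℝ) → ℝ} (hg : Measurable g) (hb : ∀ x, |g x| ≤ 1)
    (ψ : Data N) : MemLp (fun x => (g x : ℂ) * ψ x) 2 volume := by
  refine (Lp.memLp ψ).mono ?_ (Filter.Eventually.of_forall fun x => ?_)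
  · exact (Complex.measurable_ofReal.comp hg).aestronglyMeasurable.mul
      (Lp.aestronglyMeasurable ψ)
  · rw [norm_mul, Complex.norm_real, Real.norm_eq_abs]
    exact mul_le_of_le_one_left (norm_nonneg _) (hb x)

theorem coeFn_mulFun {N : ℕ} {g : (Fin N → ℝ) → ℝ} (hg : Measurable g) (hb : ∀ x, |g x| ≤ 1)
    (ψ : Data N) : ⇑(mulFun g ψ) =ᵐ[volume] fun x => (g x : ℂ) * ψ x := by
  rw [mulFun, dif_pos (memLp_mulFun hg hb ψ)]
  exact MemLp.coeFn_toLp _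

/-- Multiplication by a measurable function bounded by `1`, as a linear map. -/
def mulLin {N : ℕ} (g : (Fin N → ℝ) → ℝ) (hg : Measurable g) (hb : ∀ x, |g x| ≤ 1) :
    Data N →ₗ[ℂ] Data N where
  toFun := mulFun g
  map_add' ψ χ := by
    apply Lp.ext
    filter_upwards [coeFn_mulFun hg hb (ψ + χ), coeFn_mulFun hg hb ψ, coeFn_mulFun hg hb χ,
      Lp.coeFn_add ψ χ, Lp.coeFn_add (mulFun g ψ) (mulFun g χ)] with x h1 h2 h3 h4 h5
    rw [h1, h5, Pi.add_apply, h2, h3, h4, Pi.add_apply, mul_add]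
  map_smul' a ψ := by
    apply Lp.ext
    filter_upwards [coeFn_mulFun hg hb (a • ψ), coeFn_mulFun hg hb ψ,
      Lp.coeFn_smul a ψ, Lp.coeFn_smul a (mulFun g ψ)] with x h1 h2 h3 h4
    rw [h1, RingHom.id_apply, h4, Pi.smul_apply, h2, h3, Pi.smul_apply, smul_eq_mul, smul_eq_mul]
    ring

theorem mulLin_apply {N : ℕ} {g : (Fin N → ℝ) → ℝ} (hg : Measurable g) (hb : ∀ x, |g x| ≤ 1)
    (ψ : Data N) : mulLin g hg hb ψ = mulFun g ψ := rfl

theorem mulLin_comm {N : ℕ} {g k : (Fin N → ℝ) → ℝ} (hg : Measurable g) (hb : ∀ x, |g x| ≤ 1)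
    (hk : Measurable k) (hc : ∀ x, |k x| ≤ 1) (ψ : Data N) :
    mulLin g hg hb (mulLin k hk hc ψ) = mulLin k hk hc (mulLin g hg hb ψ) := by
  simp only [mulLin_apply]
  apply Lp.ext
  filter_upwards [coeFn_mulFun hg hb ψ, coeFn_mulFun hk hc ψ, coeFn_mulFun hg hb (mulFun k ψ),
    coeFn_mulFun hk hc (mulFun g ψ)] with x h1 h2 h3 h4
  rw [h3, h4, h1, h2]; ring

theorem mulLin_mulLin_add {N : ℕ} {g k : (Fin N → ℝ) → ℝ} (hg : Measurable g)
    (hb : ∀ x, |g x| ≤ 1) (hk : Measurable k) (hc : ∀ x, |k x| ≤ 1)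
    (h : ∀ x, g x ^ 2 + k x ^ 2 = 1) (ψ : Data N) :
    mulLin g hg hb (mulLin g hg hb ψ) + mulLin k hk hc (mulLin k hk hc ψ) = ψ := by
  simp only [mulLin_apply]
  apply Lp.ext
  filter_upwards [coeFn_mulFun hg hb ψ, coeFn_mulFun hk hc ψ, coeFn_mulFun hg hb (mulFun g ψ),
    coeFn_mulFun hk hc (mulFun k ψ), Lp.coeFn_add (mulFun g (mulFun g ψ)) (mulFun k (mulFun k ψ))]
    with x h1 h2 h3 h4 h5
  rw [h5, Pi.add_apply, h3, h4, h1, h2]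
  have : (g x : ℂ) ^ 2 + (k x : ℂ) ^ 2 = 1 := by exact_mod_cast h x
  linear_combination (ψ x) * this

theorem inner_mulLin {N : ℕ} {g : (Fin N → ℝ) → ℝ} (hg : Measurable g) (hb : ∀ x, |g x| ≤ 1)
    (ψ χ : Data N) : inner ℂ (mulLin g hg hb ψ) χ = inner ℂ ψ (mulLin g hg hb χ) := by
  simp only [mulLin_apply]
  rw [L2.inner_def, L2.inner_def]
  refine integral_congr_ae ?_
  filter_upwards [coeFn_mulFun hg hb ψ, coeFn_mulFun hg hb χ] with x h1 h2
  simp only [RCLike.inner_apply]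
  rw [h1, h2, map_mul, Complex.conj_ofReal]; ring

/-! ### Amplitude estimation -/

/-- Successive application of the loading unitaries in a list of registers. -/
def loadAll {N : ℕ} (load : Fin N → (Data N ≃ₗᵢ[ℂ] Data N)) : List (Fin N) →
    (Data N ≃ₗᵢ[ℂ] Data N)
  | [] => LinearIsometryEquiv.refl ℂ _
  | i :: l => (load i).trans (loadAll load l)

/-- The state obtained by running a list of gates on `ψ`. -/
def applyGates {N d : ℕ} {K : Fin N → ℕ} (O : OracleSet N K) (l : List (Gate N K d))
    (ψ : QState N d) : QState N d :=
  l.foldl (fun ψ G => G.apply O ψ) ψ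

theorem applyGates_append {N d : ℕ} {K : Fin N → ℕ} (O : OracleSet N K) (l l' : List (Gate N K d))
    (ψ : QState N d) : applyGates O (l ++ l') ψ = applyGates O l' (applyGates O l ψ) :=
  List.foldl_append

theorem applyGates_cons {N d : ℕ} {K : Fin N → ℕ} (O : OracleSet N K) (G : Gate N K d)
    (l : List (Gate N K d)) (ψ : QState N d) :
    applyGates O (G :: l) ψ = applyGates O l (G.apply O ψ) := rfl

theorem applyGates_nil {N d : ℕ} {K : Fin N → ℕ} (O : OracleSet N K) (ψ : QState N d) :
    applyGates O [] ψ = ψ := rfl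

theorem applyGates_load {N d : ℕ} {K : Fin N → ℕ} (O : OracleSet N K) (l : List (Fin N))
    (ψ : QState N d) :
    applyGates O (l.map fun i => Gate.load i false Finset.univ) ψ
      = fun α => loadAll O.load l (ψ α) := by
  induction l generalizing ψ with
  | nil => rfl
  | cons i l ih =>
    rw [List.map_cons, applyGates_cons, ih]
    funext α
    simp [Gate.apply, loadAll]

theorem applyGates_load_symm {N d : ℕ} {K : Fin N → ℕ} (O : OracleSet N K) (l : List (Fin N))
    (ψ : QState N d) :
    applyGates O (l.reverse.map fun i => Gate.load i true Finset.univ) ψ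
      = fun α => (loadAll O.load l).symm (ψ α) := by
  induction l generalizing ψ with
  | nil => rfl
  | cons i l ih =>
    rw [List.reverse_cons, List.map_append, applyGates_append, ih]
    funext α
    simp [applyGates, Gate.apply, loadAll]

/-- The sign flip of the labels `(false, j)`, `j ∈ ctl`. -/
def signFlip {d : ℕ} (ctl : Finset (Fin (d + 1))) : Matrix.unitaryGroup (Anc d) ℂ :=
  ⟨Matrix.diagonal fun α => if α.1 = false ∧ α.2 ∈ ctl then -1 else 1, by
    rw [Matrix.mem_unitaryGroup_iff, Matrix.star_eq_conjTranspose, Matrix.diagonal_conjTranspose,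
      Matrix.diagonal_mul_diagonal, ← Matrix.diagonal_one]
    congr 1
    funext α
    rw [Pi.star_apply]
    split_ifs <;> simp⟩

/-- The preparation of the amplitude to be estimated: load the registers in `l`, then rotate the
target qubit by `W`. -/
def prepGates {N d : ℕ} {K : Fin N → ℕ} (l : List (Fin N))
    (W : Bool → Finset (Fin (d + 1)) → Gate N K d) : List (Gate N K d) :=
  (l.map fun i => Gate.load i false Finset.univ) ++ [W false Finset.univ]

/-- The inverse of `prepGates`. -/
def unprepGates {N d : ℕ} {K : Fin N → ℕ} (l : List (Fin N))
    (W : Bool → Finset (Fin (d + 1)) → Gate N K d) : List (Gate N K d) :=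
  W true Finset.univ :: (l.reverse.map fun i => Gate.load i true Finset.univ)

/-- The Grover iteration, controlled on the work register lying in `ctl`. Only the two reflections
carry the control: outside `ctl` the preparation and its inverse cancel. -/
def groverGates {N d : ℕ} {K : Fin N → ℕ} (l : List (Fin N))
    (W : Bool → Finset (Fin (d + 1)) → Gate N K d) (ctl : Finset (Fin (d + 1))) :
    List (Gate N K d) :=
  Gate.anc (signFlip ctl) :: (unprepGates l W ++ Gate.ancIfZero (signFlip ctl) :: prepGates l W)

theorem sqrt_sq_add_sqrt_one_sub_sq {t : ℝ} (ht : t ∈ Set.Icc (0 : ℝ) 1) :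
    √(1 - t) ^ 2 + √t ^ 2 = 1 := by
  rw [Real.sq_sqrt (by linarith [ht.2]), Real.sq_sqrt ht.1]; ring

theorem abs_sqrt_le_one {t : ℝ} (ht : t ≤ 1) : |√t| ≤ 1 := by
  rw [abs_of_nonneg (Real.sqrt_nonneg _)]; exact Real.sqrt_le_one.2 ht

section Grover

variable {N d : ℕ} {K : Fin N → ℕ} {O : OracleSet N K} {φ : (Fin N → ℝ) → ℝ}
  {W : Bool → Finset (Fin (d + 1)) → Gate N K d}

theorem applyGates_prepGates (l : List (Fin N))
    (hW : ∀ inv ctl ψ, (W inv ctl).apply O ψ = applyRot φ inv ctl ψ) (ψ : QState N d) :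
    applyGates O (prepGates l W) ψ
      = applyRot φ false Finset.univ fun α => loadAll O.load l (ψ α) := by
  rw [prepGates, applyGates_append, applyGates_load, applyGates_cons, hW, applyGates_nil]

theorem applyGates_unprepGates (l : List (Fin N))
    (hW : ∀ inv ctl ψ, (W inv ctl).apply O ψ = applyRot φ inv ctl ψ) (ψ : QState N d) :
    applyGates O (unprepGates l W) ψ
      = fun α => (loadAll O.load l).symm (applyRot φ true Finset.univ ψ α) := by
  rw [unprepGates, applyGates_cons, hW, applyGates_load_symm]

/-- The action of the controlled Grover iteration: a reflection of the target qubit followed by the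
reflection at the prepared state. -/
theorem applyGates_groverGates (l : List (Fin N)) (hφ : Measurable φ)
    (hφ01 : ∀ x, φ x ∈ Set.Icc (0 : ℝ) 1)
    (hW : ∀ inv ctl ψ, (W inv ctl).apply O ψ = applyRot φ inv ctl ψ)
    (ctl : Finset (Fin (d + 1))) (ψ : QState N d) {B G : Data N}
    (hB : B = mulFun (fun x => √(1 - φ x)) (loadAll O.load l O.init))
    (hG : G = mulFun (fun x => √(φ x)) (loadAll O.load l O.init)) (j : Fin (d + 1)) :
    (j ∉ ctl → ∀ β, applyGates O (groverGates l W ctl) ψ (β, j) = ψ (β, j)) ∧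
    (j ∈ ctl → applyGates O (groverGates l W ctl) ψ (false, j) = -ψ (false, j)
        - (2 * (inner ℂ G (ψ (true, j)) - inner ℂ B (ψ (false, j)))) • B ∧
      applyGates O (groverGates l W ctl) ψ (true, j) = ψ (true, j)
        - (2 * (inner ℂ G (ψ (true, j)) - inner ℂ B (ψ (false, j)))) • G) := by
  have hc : Measurable fun x => √(1 - φ x) := (measurable_const.sub hφ).sqrt
  have hs : Measurable fun x => √(φ x) := hφ.sqrt
  have hcb : ∀ x, |√(1 - φ x)| ≤ 1 := fun x => abs_sqrt_le_one (by linarith [(hφ01 x).1])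
  have hsb : ∀ x, |√(φ x)| ≤ 1 := fun x => abs_sqrt_le_one (hφ01 x).2
  set c := mulLin _ hc hcb with hcdef
  set s := mulLin _ hs hsb with hsdef
  have hcf : ∀ v : Data N, mulFun (fun x => √(1 - φ x)) v = c v := fun _ => rfl
  have hsf : ∀ v : Data N, mulFun (fun x => √(φ x)) v = s v := fun _ => rfl
  have hcs : ∀ v, c (s v) = s (c v) := mulLin_comm hc hcb hs hsb
  have hone : ∀ v, c (c v) + s (s v) = v :=
    mulLin_mulLin_add hc hcb hs hsb fun x => sqrt_sq_add_sqrt_one_sub_sq (hφ01 x)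
  have hcadj : ∀ v w, inner ℂ (c v) w = inner ℂ v (c w) := inner_mulLin hc hcb
  have hsadj : ∀ v w, inner ℂ (s v) w = inner ℂ v (s w) := inner_mulLin hs hsb
  set Λ := loadAll O.load l with hΛ
  rw [hcf] at hB
  rw [hsf] at hG
  -- The sign flip of the target qubit.
  set v : QState N d := (Gate.anc (signFlip ctl)).apply O ψ with hv
  have hv' : ∀ α, v α = if α.1 = false ∧ α.2 ∈ ctl then -ψ α else ψ α := by
    intro α
    simp only [hv, Gate.apply, signFlip, Matrix.diagonal_apply, ite_smul, zero_smul,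
      Finset.sum_ite_eq, Finset.mem_univ, if_true]
    split_ifs <;> simp
  set u : QState N d := applyGates O (unprepGates l W) v with hu
  have huf : u (false, j) = Λ.symm (c (v (false, j)) + s (v (true, j))) := by
    rw [hu, applyGates_unprepGates l hW]
    simp [applyRot, hcf, hsf, add_comm, hΛ]
  have hut : u (true, j) = Λ.symm (c (v (true, j)) - s (v (false, j))) := by
    rw [hu, applyGates_unprepGates l hW]
    simp [applyRot, hcf, hsf, hΛ]
  set t : QState N d := (Gate.ancIfZero (signFlip ctl)).apply O u with ht
  have ht' : ∀ α, t α = if α.1 = false ∧ α.2 ∈ ctl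
      then u α - (2 * inner ℂ O.init (u α)) • O.init else u α := by
    intro α
    simp only [ht, Gate.apply, signFlip, Matrix.diagonal_apply, ite_mul, zero_mul, ite_smul,
      zero_smul, Finset.sum_ite_eq, Finset.mem_univ, if_true]
    split_ifs
    · rw [two_mul, add_smul, neg_one_mul, neg_smul]; abel
    · simp
  have hfin : applyGates O (groverGates l W ctl) ψ
      = applyRot φ false Finset.univ fun α => Λ (t α) := by
    rw [groverGates, applyGates_cons, applyGates_append, applyGates_cons,
      applyGates_prepGates l hW]
  have hfinf : applyGates O (groverGates l W ctl) ψ (false, j)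
      = c (Λ (t (false, j))) - s (Λ (t (true, j))) := by
    rw [hfin]; simp [applyRot, hcf, hsf]
  have hfint : applyGates O (groverGates l W ctl) ψ (true, j)
      = s (Λ (t (false, j))) + c (Λ (t (true, j))) := by
    rw [hfin]; simp [applyRot, hcf, hsf]
  have htt : Λ (t (true, j)) = c (v (true, j)) - s (v (false, j)) := by
    rw [ht', if_neg (by simp), hut, Λ.apply_symm_apply]
  constructor
  · intro hj β
    have htf : Λ (t (false, j)) = c (v (false, j)) + s (v (true, j)) := by
      rw [ht', if_neg (by simp [hj]), huf, Λ.apply_symm_apply]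
    have hvf : v (false, j) = ψ (false, j) := by rw [hv', if_neg (by simp [hj])]
    have hvt : v (true, j) = ψ (true, j) := by rw [hv', if_neg (by simp)]
    cases β
    · rw [hfinf, htf, htt, hvf, hvt, map_add, map_sub, hcs]
      conv_rhs => rw [← hone (ψ (false, j))]
      abel
    · rw [hfint, htf, htt, hvf, hvt, map_add, map_sub, hcs]
      conv_rhs => rw [← hone (ψ (true, j))]
      abel
  · intro hj
    have hvf : v (false, j) = -ψ (false, j) := by rw [hv', if_pos (by simp [hj])]
    have hvt : v (true, j) = ψ (true, j) := by rw [hv', if_neg (by simp)]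
    have hz : inner ℂ O.init (u (false, j))
        = inner ℂ G (ψ (true, j)) - inner ℂ B (ψ (false, j)) := by
      rw [huf, ← Λ.inner_map_map, Λ.apply_symm_apply, inner_add_right, ← hcadj, ← hsadj, ← hB,
        ← hG, hvf, hvt, inner_neg_right]
      ring
    have htf : Λ (t (false, j)) = c (v (false, j)) + s (v (true, j))
        - (2 * (inner ℂ G (ψ (true, j)) - inner ℂ B (ψ (false, j)))) • Λ O.init := by
      rw [ht', if_pos (by simp [hj]), hz, map_sub, map_smul, huf, Λ.apply_symm_apply]
    generalize (2 * (inner ℂ G (ψ (true, j)) - inner ℂ B (ψ (false, j))) : ℂ) = z at htf ⊢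
    constructor
    · rw [hfinf, htf, htt, map_sub, map_smul, ← hB, map_add, map_sub, hcs, ← hvf]
      conv_rhs => rw [← hone (v (false, j))]
      abel
    · rw [hfint, htf, htt, map_sub, map_smul, ← hG, map_add, map_sub, hcs, ← hvt]
      conv_rhs => rw [← hone (v (true, j))]
      abel

end Grover

/-- Every vector is its norm times a unit vector; for `v = 0` that vector is `e`. -/
theorem exists_unit_smul {E : Type*} [NormedAddCommGroup E] [NormedSpace ℂ E] {e : E}
    (he : ‖e‖ = 1) (v : E) : ∃ u : E, ‖u‖ = 1 ∧ v = (‖v‖ : ℂ) • u := by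
  by_cases hv : v = 0
  · exact ⟨e, he, by simp [hv]⟩
  · refine ⟨((‖v‖ : ℂ)⁻¹) • v, ?_, ?_⟩
    · rw [norm_smul]; simp [hv]
    · rw [smul_smul, mul_inv_cancel₀ (by simpa using hv), one_smul]

/-- Powers of the Grover iteration rotate the prepared state: after the iterations controlled on
`j ≥ 1, …, j ≥ n`, the label `j` carries the angle `(2 min(j,n) + 1) θ`. -/
theorem applyGates_grover_flatMap {N d : ℕ} {K : Fin N → ℕ} {O : OracleSet N K}
    {φ : (Fin N → ℝ) → ℝ} {W : Bool → Finset (Fin (d + 1)) → Gate N K d} (l : List (Fin N))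
    (hφ : Measurable φ) (hφ01 : ∀ x, φ x ∈ Set.Icc (0 : ℝ) 1)
    (hW : ∀ inv ctl ψ, (W inv ctl).apply O ψ = applyRot φ inv ctl ψ)
    {b g : Data N} (hb : ‖b‖ = 1) (hg : ‖g‖ = 1) {θ : ℝ}
    (hB : (Real.cos θ : ℂ) • b = mulFun (fun x => √(1 - φ x)) (loadAll O.load l O.init))
    (hG : (Real.sin θ : ℂ) • g = mulFun (fun x => √(φ x)) (loadAll O.load l O.init))
    (w : Fin (d + 1) → ℂ) (ψ : QState N d)
    (hψf : ∀ j, ψ (false, j) = (w j * (Real.cos θ : ℝ)) • b)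
    (hψt : ∀ j, ψ (true, j) = (w j * (Real.sin θ : ℝ)) • g) (n : ℕ) (j : Fin (d + 1)) :
    applyGates O ((List.range n).flatMap fun t =>
        groverGates l W (Finset.univ.filter fun j => t + 1 ≤ (j : ℕ))) ψ (false, j)
      = (w j * (Real.cos ((2 * (min (j : ℕ) n : ℕ) + 1) * θ) : ℝ)) • b ∧
    applyGates O ((List.range n).flatMap fun t =>
        groverGates l W (Finset.univ.filter fun j => t + 1 ≤ (j : ℕ))) ψ (true, j)
      = (w j * (Real.sin ((2 * (min (j : ℕ) n : ℕ) + 1) * θ) : ℝ)) • g := by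
  induction n with
  | zero => simp [applyGates_nil, hψf, hψt]
  | succ n ih =>
    rw [List.range_succ, List.flatMap_append, applyGates_append, List.flatMap_singleton]
    set χ := applyGates O ((List.range n).flatMap fun t =>
        groverGates l W (Finset.univ.filter fun j => t + 1 ≤ (j : ℕ))) ψ with hχ
    obtain ⟨h1, h2⟩ := applyGates_groverGates l hφ hφ01 hW
      (Finset.univ.filter fun j : Fin (d + 1) => n + 1 ≤ (j : ℕ)) χ hB hG j
    by_cases hj : n + 1 ≤ (j : ℕ)
    · obtain ⟨h3, h4⟩ := h2 (by simpa using hj)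
      rw [h3, h4, ih.1, ih.2]
      have m1 : min (j : ℕ) n = n := by omega
      have m2 : min (j : ℕ) (n + 1) = n + 1 := by omega
      rw [m1, m2]
      have hbb : inner ℂ b b = (1 : ℂ) := by rw [inner_self_eq_norm_sq_to_K, hb]; simp
      have hgg : inner ℂ g g = (1 : ℂ) := by rw [inner_self_eq_norm_sq_to_K, hg]; simp
      set x : ℝ := (2 * (n : ℝ) + 1) * θ with hx
      have e : (2 * ((n + 1 : ℕ) : ℝ) + 1) * θ = x + 2 * θ := by rw [hx]; push_cast; ring
      rw [e, Real.cos_add, Real.sin_add, Real.cos_two_mul, Real.sin_two_mul]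
      simp only [inner_smul_left, inner_smul_right, hbb, hgg, Complex.conj_ofReal]
      have hsc : (Real.sin θ : ℂ) ^ 2 = 1 - (Real.cos θ : ℂ) ^ 2 := by
        rw [eq_sub_iff_add_eq]; exact_mod_cast Real.sin_sq_add_cos_sq θ
      constructor
      · rw [smul_smul, ← neg_smul, ← sub_smul]
        congr 1
        push_cast
        ring
      · rw [smul_smul, ← sub_smul]
        congr 1
        push_cast at hsc ⊢
        linear_combination (-2 * w j * Complex.sin x) * hsc
    · have m1 : min (j : ℕ) (n + 1) = min (j : ℕ) n := by omega
      rw [h1 (by simpa using hj), h1 (by simpa using hj), m1]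
      exact ih

/-- The amplitude-estimation circuit: superpose the work labels by `V₁`, prepare, apply the Grover
iterations controlled on `j ≥ 1, …, j ≥ d`, and read the phase with `V₂`. -/
def estimationCircuit {N d : ℕ} {K : Fin N → ℕ} (l : List (Fin N))
    (W : Bool → Finset (Fin (d + 1)) → Gate N K d) (V₁ V₂ : Matrix.unitaryGroup (Anc d) ℂ) :
    List (Gate N K d) :=
  Gate.anc V₁ :: (prepGates l W ++ (((List.range d).flatMap fun t =>
    groverGates l W (Finset.univ.filter fun j => t + 1 ≤ (j : ℕ))) ++ [Gate.anc V₂]))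

theorem sum_map_estimationCircuit {N d : ℕ} {K : Fin N → ℕ} (l : List (Fin N))
    (W : Bool → Finset (Fin (d + 1)) → Gate N K d) (V₁ V₂ : Matrix.unitaryGroup (Anc d) ℂ)
    (cnt : Gate N K d → ℕ) (p q : ℕ) (h1 : ∀ V, cnt (.anc V) = 0) (h2 : ∀ V, cnt (.ancIfZero V) = 0)
    (h3 : ∀ i inv ctl, cnt (.load i inv ctl) = p) (h4 : ∀ inv ctl, cnt (W inv ctl) = q) :
    ((estimationCircuit l W V₁ V₂).map cnt).sum = (2 * d + 1) * (l.length * p + q) := by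
  have hp : ((prepGates l W).map cnt).sum = l.length * p + q := by
    simp [prepGates, h3, h4, Function.comp_def]
  have hu : ((unprepGates l W).map cnt).sum = l.length * p + q := by
    simp [unprepGates, h3, h4, Function.comp_def, add_comm]
  have hgr : ∀ ctl, ((groverGates l W ctl).map cnt).sum = 2 * (l.length * p + q) := by
    intro ctl
    rw [groverGates, List.map_cons, List.sum_cons, List.map_append, List.sum_append, List.map_cons,
      List.sum_cons, hp, hu, h1, h2]
    ring
  have hf : ∀ n, (((List.range n).flatMap fun t =>
      groverGates l W (Finset.univ.filter fun j => t + 1 ≤ (j : ℕ))).map cnt).sum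
      = n * (2 * (l.length * p + q)) := by
    intro n
    induction n with
    | zero => simp
    | succ n ih =>
      rw [List.range_succ, List.flatMap_append, List.map_append, List.sum_append, ih,
        List.flatMap_singleton, hgr]
      ring
  rw [estimationCircuit, List.map_cons, List.sum_cons, List.map_append, List.sum_append,
    List.map_append, List.sum_append, hp, hf, h1, List.map_singleton, List.sum_singleton, h1]
  ring

open Classical in
/-- Amplitude estimation. With `(m + 1) L` work labels, the probability `‖√φ χ‖²` of the target
qubit in the loaded state `χ` is found up to `η`, except with probability `(m + 1) / (L η)^(2m)`.
-/
theorem exists_amplitude_estimation {N : ℕ} {K : Fin N → ℕ} (L m : ℕ) (hL : 1 ≤ L)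
    (l : List (Fin N)) (W : ∀ d, Bool → Finset (Fin (d + 1)) → Gate N K d) :
    ∃ (d : ℕ) (gates : List (Gate N K d)) (est : Anc d → ℝ), d + 1 = (m + 1) * L ∧
      (∀ (cnt : Gate N K d → ℕ) (p q : ℕ), (∀ V, cnt (.anc V) = 0) →
        (∀ V, cnt (.ancIfZero V) = 0) → (∀ i inv ctl, cnt (.load i inv ctl) = p) →
        (∀ inv ctl, cnt (W d inv ctl) = q) →
        (gates.map cnt).sum = (2 * d + 1) * (l.length * p + q)) ∧
      ∀ (O : OracleSet N K) (φ : (Fin N → ℝ) → ℝ), ‖O.init‖ = 1 → Measurable φ →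
        (∀ x, φ x ∈ Set.Icc (0 : ℝ) 1) →
        (∀ d inv ctl ψ, (W d inv ctl).apply O ψ = applyRot φ inv ctl ψ) →
        ∑ α, ‖runCircuit O gates α‖ ^ 2 = 1 ∧
        ∀ η : ℝ, 0 < η →
          ∑ α with η < |est α - ‖mulFun (fun x => √(φ x)) (loadAll O.load l O.init)‖ ^ 2|,
            ‖runCircuit O gates α‖ ^ 2 ≤ (m + 1) / (L * η) ^ (2 * m) := by
  obtain ⟨d, w, hd, hw, htail⟩ := exists_phase_window L m hL
  obtain ⟨V₁, hV₁⟩ := exists_unitary_col ((false, 0) : Anc d)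
    (fun α => if α.1 = false then w α.2 else 0) (by
      rw [Fintype.sum_prod_type, Fintype.sum_bool]; simp [hw])
  set F : Matrix.unitaryGroup (Fin (d + 1)) ℂ :=
    ⟨fourierMatrix d, fourierMatrix_mem_unitary d⟩ with hF
  have hV₂mem : Matrix.kroneckerMap (· * ·) (1 : Matrix Bool Bool ℂ) (fourierMatrix d) ∈
      Matrix.unitaryGroup (Anc d) ℂ :=
    Matrix.kronecker_mem_unitary (one_mem _) (fourierMatrix_mem_unitary d)
  refine ⟨d, estimationCircuit l (W d) V₁ ⟨_, hV₂mem⟩, fun α => phaseValue d α.2, hd,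
    fun cnt p q h1 h2 h3 h4 => sum_map_estimationCircuit l (W d) V₁ _ cnt p q h1 h2 h3 h4, ?_⟩
  intro O φ hinit hφ hφ01 hW
  have hc : Measurable fun x => √(1 - φ x) := (measurable_const.sub hφ).sqrt
  have hs : Measurable fun x => √(φ x) := hφ.sqrt
  have hcb : ∀ x, |√(1 - φ x)| ≤ 1 := fun x => abs_sqrt_le_one (by linarith [(hφ01 x).1])
  have hsb : ∀ x, |√(φ x)| ≤ 1 := fun x => abs_sqrt_le_one (hφ01 x).2
  set χ := loadAll O.load l O.init with hχ
  have hχn : ‖χ‖ = 1 := by rw [hχ, LinearIsometryEquiv.norm_map, hinit]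
  set B := mulFun (fun x => √(1 - φ x)) χ with hBdef
  set G := mulFun (fun x => √(φ x)) χ with hGdef
  have hBG : ‖B‖ ^ 2 + ‖G‖ ^ 2 = 1 := by
    have h1 : inner ℂ B B + inner ℂ G G = (1 : ℂ) := by
      have e1 : inner ℂ B B = inner ℂ χ (mulLin _ hc hcb (mulLin _ hc hcb χ)) :=
        inner_mulLin hc hcb _ _
      have e2 : inner ℂ G G = inner ℂ χ (mulLin _ hs hsb (mulLin _ hs hsb χ)) :=
        inner_mulLin hs hsb _ _
      rw [e1, e2, ← inner_add_right, mulLin_mulLin_add hc hcb hs hsb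
        fun x => sqrt_sq_add_sqrt_one_sub_sq (hφ01 x), inner_self_eq_norm_sq_to_K, hχn]
      simp
    rw [inner_self_eq_norm_sq_to_K, inner_self_eq_norm_sq_to_K] at h1
    simp only [Complex.coe_algebraMap] at h1
    exact_mod_cast h1
  -- `B` and `G` are the components of the prepared state with target qubit `false` and `true`.
  set θ := Real.arcsin ‖G‖ with hθ
  have hG1 : ‖G‖ ≤ 1 := by nlinarith [norm_nonneg G, sq_nonneg ‖B‖]
  have hsin : Real.sin θ = ‖G‖ := Real.sin_arcsin (by linarith [norm_nonneg G]) hG1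
  have hcos : Real.cos θ = ‖B‖ := by
    rw [hθ, Real.cos_arcsin, ← hBG, add_sub_cancel_right, Real.sqrt_sq (norm_nonneg _)]
  obtain ⟨b, hb, hBb⟩ := exists_unit_smul hinit B
  obtain ⟨g, hg, hGg⟩ := exists_unit_smul hinit G
  have hrun : ∀ y : Fin (d + 1),
      ‖runCircuit O (estimationCircuit l (W d) V₁ ⟨_, hV₂mem⟩) (true, y)‖ ^ 2
        = ‖∑ j : Fin (d + 1), fourierMatrix d y j *
            (w j * (Real.sin ((2 * (j : ℕ) + 1) * θ) : ℝ))‖ ^ 2 ∧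
      ‖runCircuit O (estimationCircuit l (W d) V₁ ⟨_, hV₂mem⟩) (false, y)‖ ^ 2
        = ‖∑ j : Fin (d + 1), fourierMatrix d y j *
            (w j * (Real.cos ((2 * (j : ℕ) + 1) * θ) : ℝ))‖ ^ 2 := by
    intro y
    have e0 : ∀ α, (Gate.anc V₁ : Gate N K d).apply O
        (fun α => if α = (false, 0) then O.init else 0) α
        = (if α.1 = false then w α.2 else 0) • O.init := by
      intro α
      simp only [Gate.apply, smul_ite, smul_zero, Finset.sum_ite_eq', Finset.mem_univ, if_true,
        hV₁]
    set ψ₀ : QState N d := (Gate.anc V₁ : Gate N K d).apply O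
      (fun α => if α = (false, 0) then O.init else 0) with hψ₀
    set ψ₁ : QState N d := applyGates O (prepGates l (W d)) ψ₀ with hψ₁
    have e1f : ∀ j, ψ₁ (false, j) = (w j * (Real.cos θ : ℝ)) • b := by
      intro j
      rw [hψ₁, applyGates_prepGates l (hW d)]
      simp only [applyRot, Finset.mem_univ, if_true, e0]
      simp only [Bool.not_false, map_smul, ← hχ]
      have h2 := (mulLin _ hc hcb).map_smul (w j) χ
      have h3 := (mulLin _ hs hsb).map_zero
      simp only [mulLin_apply] at h2 h3
      simp only [reduceCtorEq, if_false, h2, zero_smul, h3, sub_zero]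
      rw [← hBdef, hBb, hcos, smul_smul]
    have e1t : ∀ j, ψ₁ (true, j) = (w j * (Real.sin θ : ℝ)) • g := by
      intro j
      rw [hψ₁, applyGates_prepGates l (hW d)]
      simp only [applyRot, Finset.mem_univ, if_true, e0]
      simp only [Bool.not_true, map_smul, ← hχ]
      have h2 := (mulLin _ hs hsb).map_smul (w j) χ
      have h3 := (mulLin _ hc hcb).map_zero
      simp only [mulLin_apply] at h2 h3
      simp only [reduceCtorEq, if_false, if_true, h2, zero_smul, h3, add_zero]
      rw [← hGdef, hGg, hsin, smul_smul]
    have e2 := applyGates_grover_flatMap l hφ hφ01 (hW d) hb hg (θ := θ)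
      (by rw [hcos, ← hBb]) (by rw [hsin, ← hGg]) w ψ₁ e1f e1t d
    have e3 : runCircuit O (estimationCircuit l (W d) V₁ ⟨_, hV₂mem⟩)
        = (Gate.anc ⟨_, hV₂mem⟩ : Gate N K d).apply O
          (applyGates O ((List.range d).flatMap fun t =>
            groverGates l (W d) (Finset.univ.filter fun j => t + 1 ≤ (j : ℕ))) ψ₁) := by
      change applyGates O _ _ = _
      rw [estimationCircuit, applyGates_cons, applyGates_append, applyGates_append,
        applyGates_cons, applyGates_nil]
    have hmin : ∀ j : Fin (d + 1), min (j : ℕ) d = j := fun j => by omega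
    simp only [hmin] at e2
    rw [e3]
    simp only [Gate.apply, Matrix.kroneckerMap_apply, Fintype.sum_prod_type, Fintype.sum_bool, e2]
    simp only [Matrix.one_apply, if_true, reduceCtorEq, if_false, zero_mul, zero_smul, one_mul,
      Finset.sum_const_zero, zero_add, add_zero, smul_smul, ← Finset.sum_smul, norm_smul, hb, hg,
      mul_one, and_self]
  constructor
  · rw [Fintype.sum_prod_type, Fintype.sum_bool]
    simp only [hrun]
    have p1 := sum_norm_sq_unitary F (fun j => w j * (Real.sin ((2 * (j : ℕ) + 1) * θ) : ℝ))
    have p2 := sum_norm_sq_unitary F (fun j => w j * (Real.cos ((2 * (j : ℕ) + 1) * θ) : ℝ))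
    simp only [hF] at p1 p2
    rw [p1, p2, ← Finset.sum_add_distrib, ← hw]
    refine Finset.sum_congr rfl fun j _ => ?_
    rw [norm_mul, norm_mul, Complex.norm_real, Complex.norm_real, mul_pow, mul_pow,
      Real.norm_eq_abs, Real.norm_eq_abs, sq_abs, sq_abs, ← mul_add, Real.sin_sq_add_cos_sq,
      mul_one]
  · intro η hη
    refine le_trans (le_of_eq ?_) (htail θ η hη)
    rw [Finset.sum_filter, Fintype.sum_prod_type, Fintype.sum_bool, ← Finset.sum_add_distrib,
      Finset.sum_filter]
    refine Finset.sum_congr rfl fun y _ => ?_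
    simp only [hrun, ← hsin]
    split_ifs <;> simp

open Filter Topology ProbabilityTheory

/-! ### Distribution functions without atoms -/

theorem continuous_cdf (ν : Measure ℝ) [IsProbabilityMeasure ν] [NullSingletonClass ν] :
    Continuous (cdf ν) := by
  rw [continuous_iff_continuousAt]
  intro x
  have h : (cdf ν).measure {x} = 0 := by rw [measure_cdf]; exact measure_singleton x
  rw [StieltjesFunction.measure_singleton, ENNReal.ofReal_eq_zero, sub_nonpos] at h
  exact (monotone_cdf ν).continuousAt_iff_leftLim_eq_rightLim.2 (by
    rw [StieltjesFunction.rightLim_eq]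
    exact le_antisymm ((monotone_cdf ν).leftLim_le le_rfl) h)

/-- The probability integral transform. -/
theorem map_cdf_eq_uniform (ν : Measure ℝ) [IsProbabilityMeasure ν] [NullSingletonClass ν] :
    ν.map (cdf ν) = volume.restrict (Set.Icc 0 1) := by
  have hcont := continuous_cdf ν
  have hmeas : Measurable (cdf ν) := hcont.measurable
  have : IsProbabilityMeasure (ν.map (cdf ν)) := Measure.isProbabilityMeasure_map hmeas.aemeasurable
  refine Measure.ext_of_Iic _ _ fun u => ?_
  rw [Measure.map_apply hmeas measurableSet_Iic, Measure.restrict_apply measurableSet_Iic]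
  rcases lt_or_ge u 0 with hu | hu
  · have e1 : cdf ν ⁻¹' Set.Iic u = ∅ := by
      ext x; simpa using hu.trans_le (cdf_nonneg ν x)
    have e2 : Set.Iic u ∩ Set.Icc (0 : ℝ) 1 = ∅ := by
      ext x; simp only [Set.mem_inter_iff, Set.mem_Iic, Set.mem_Icc, Set.mem_empty_iff_false,
        iff_false]; intro h; linarith [h.1, h.2.1]
    rw [e1, e2]; simp
  rcases le_or_gt 1 u with hu1 | hu1
  · have e1 : cdf ν ⁻¹' Set.Iic u = Set.univ := by
      ext x; simpa using (cdf_le_one ν x).trans hu1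
    have e2 : Set.Iic u ∩ Set.Icc (0 : ℝ) 1 = Set.Icc 0 1 :=
      Set.inter_eq_right.2 fun x hx => hx.2.trans hu1
    rw [e1, e2]; simp
  have e2 : Set.Iic u ∩ Set.Icc (0 : ℝ) 1 = Set.Icc 0 u := by
    ext x; simp only [Set.mem_inter_iff, Set.mem_Iic, Set.mem_Icc]
    constructor
    · exact fun h => ⟨h.2.1, h.1⟩
    · exact fun h => ⟨h.2, h.1, h.2.trans hu1.le⟩
  rw [e2, Real.volume_Icc, sub_zero]
  set S := cdf ν ⁻¹' Set.Iic u with hS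
  have hbdd : BddAbove S := by
    obtain ⟨x, hx⟩ := ((tendsto_cdf_atTop ν).eventually_const_lt hu1).exists
    exact ⟨x, fun y hy => le_of_not_gt fun hxy =>
      absurd (((monotone_cdf ν) hxy.le).trans hy) (not_le.2 hx)⟩
  rcases S.eq_empty_or_nonempty with he | hne
  · have : u = 0 := by
      refine le_antisymm ?_ hu
      refine ge_of_tendsto (tendsto_cdf_atBot ν) (Eventually.of_forall fun x => ?_)
      by_contra hx
      have : x ∈ S := (not_le.1 hx).le
      simp [he] at this
    rw [he, this]; simp
  · have hcl : IsClosed S := isClosed_Iic.preimage hcont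
    have hmem : sSup S ∈ S := hcl.csSup_mem hne hbdd
    have hSeq : S = Set.Iic (sSup S) := by
      ext x
      exact ⟨fun hx => le_csSup hbdd hx, fun hx => ((monotone_cdf ν) hx).trans hmem⟩
    have hval : cdf ν (sSup S) = u := by
      refine le_antisymm hmem ?_
      have h1 : Tendsto (cdf ν) (𝓝[>] sSup S) (𝓝 (cdf ν (sSup S))) :=
        hcont.continuousAt.tendsto.mono_left nhdsWithin_le_nhds
      refine ge_of_tendsto h1 ?_
      filter_upwards [self_mem_nhdsWithin] with x hx
      by_contra hlt
      exact absurd (le_csSup hbdd (show x ∈ S from (not_le.1 hlt).le)) (not_le.2 hx)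
    rw [hSeq, ← ofReal_cdf, hval]

/-- Intervals on which the distribution function is constant have measure zero. -/
theorem measure_cdf_le_diff_Iic (ν : Measure ℝ) [IsProbabilityMeasure ν] [NullSingletonClass ν]
    (t : ℝ) : ν (cdf ν ⁻¹' Set.Iic (cdf ν t) \ Set.Iic t) = 0 := by
  have hmeas : Measurable (cdf ν) := (continuous_cdf ν).measurable
  have hsub : Set.Iic t ⊆ cdf ν ⁻¹' Set.Iic (cdf ν t) := fun x hx => monotone_cdf ν hx
  rw [measure_sdiff hsub measurableSet_Iic.nullMeasurableSet (measure_ne_top _ _),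
    ← Measure.map_apply hmeas measurableSet_Iic, map_cdf_eq_uniform,
    Measure.restrict_apply measurableSet_Iic, ← ofReal_cdf]
  have e2 : Set.Iic (cdf ν t) ∩ Set.Icc (0 : ℝ) 1 = Set.Icc 0 (cdf ν t) := by
    ext x; simp only [Set.mem_inter_iff, Set.mem_Iic, Set.mem_Icc]
    constructor
    · exact fun h => ⟨h.2.1, h.1⟩
    · exact fun h => ⟨h.2, h.1, h.2.trans (cdf_le_one ν t)⟩
  rw [e2, Real.volume_Icc, sub_zero, tsub_self]

/-! ### Functions on the unit cube -/

/-- Bounded partial derivatives on the cube make `c` Lipschitz there: the coordinates are changed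
one at a time, without leaving the cube. -/
theorem PartialsBounded.abs_sub_le {N : ℕ} {c : (Fin N → ℝ) → ℝ} {B : ℝ} (hc : PartialsBounded c B)
    {u v : Fin N → ℝ} (hu : u ∈ Set.Icc (0 : Fin N → ℝ) 1) (hv : v ∈ Set.Icc (0 : Fin N → ℝ) 1) :
    |c u - c v| ≤ B * ∑ i, |u i - v i| := by
  classical
  have hpw : ∀ s : Finset (Fin N), s.piecewise u v ∈ Set.Icc (0 : Fin N → ℝ) 1 := by
    intro s
    exact ⟨Finset.le_piecewise_of_le_of_le s hu.1 hv.1, Finset.piecewise_le_of_le_of_le s hu.2 hv.2⟩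
  have key : ∀ s : Finset (Fin N), |c (s.piecewise u v) - c v| ≤ B * ∑ i ∈ s, |u i - v i| := by
    intro s
    induction s using Finset.induction_on with
    | empty => simp
    | insert i s hi ih =>
      set w := s.piecewise u v with hw
      have hmv : |c (Function.update w i (u i)) - c (Function.update w i (w i))|
          ≤ B * |u i - w i| := by
        have hupd : ∀ t ∈ Set.Icc (0 : ℝ) 1,
            Function.update w i t ∈ Set.Icc (0 : Fin N → ℝ) 1 := by
          intro t ht
          exact ⟨le_update_iff.2 ⟨ht.1, fun j _ => (hpw s).1 j⟩,
            update_le_iff.2 ⟨ht.2, fun j _ => (hpw s).2 j⟩⟩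
        have hder : ∀ t ∈ Set.Icc (0 : ℝ) 1, ∃ D : ℝ,
            HasDerivWithinAt (fun t => c (Function.update w i t)) D (Set.Icc 0 1) t ∧ |D| ≤ B := by
          intro t ht
          obtain ⟨D, hD, hDB⟩ := hc _ (hupd t ht) i
          simp only [Function.update_idem, Function.update_self] at hD
          exact ⟨D, hD, hDB⟩
        choose! D hD hDB using hder
        exact (convex_Icc (0 : ℝ) 1).norm_image_sub_le_of_norm_hasDerivWithin_le
          (fun t ht => hD t ht) (fun t ht => hDB t ht)
          ⟨(hpw s).1 i, (hpw s).2 i⟩ ⟨hu.1 i, hu.2 i⟩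
      have hwi : w i = v i := Finset.piecewise_eq_of_notMem s u v hi
      rw [Function.update_eq_self, hwi] at hmv
      rw [Finset.piecewise_insert, ← hw, Finset.sum_insert hi, mul_add]
      calc |c (Function.update w i (u i)) - c v|
          = |(c (Function.update w i (u i)) - c w) + (c w - c v)| := by ring_nf
        _ ≤ _ := abs_add_le _ _
        _ ≤ _ := add_le_add hmv ih
  have := key Finset.univ
  rwa [Finset.piecewise_univ] at this

theorem PartialsBounded.continuousOn {N : ℕ} {c : (Fin N → ℝ) → ℝ} {B : ℝ}
    (hc : PartialsBounded c B) : ContinuousOn c (Set.Icc 0 1) := by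
  intro v hv
  rw [ContinuousWithinAt, tendsto_iff_dist_tendsto_zero]
  refine squeeze_zero' (g := fun u => B * ∑ i, |u i - v i|)
    (Eventually.of_forall fun _ => dist_nonneg) ?_ ?_
  · filter_upwards [self_mem_nhdsWithin] with u hu
    exact hc.abs_sub_le hu hv
  · have : Continuous fun u : Fin N → ℝ => B * ∑ i, |u i - v i| := by fun_prop
    have h2 := (this.tendsto v).mono_left (nhdsWithin_le_nhds (s := Set.Icc 0 1))
    simpa using h2

theorem measurable_comp_cube {N : ℕ} {c : (Fin N → ℝ) → ℝ} (hc : ContinuousOn c (Set.Icc 0 1))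
    {α : Type*} [MeasurableSpace α] {u : α → Fin N → ℝ} (hu : Measurable u)
    (hu01 : ∀ x, u x ∈ Set.Icc (0 : Fin N → ℝ) 1) : Measurable fun x => c (u x) := by
  have h1 : Measurable ((Set.Icc (0 : Fin N → ℝ) 1).domRestrict c) :=
    (continuousOn_iff_continuous_domRestrict.1 hc).measurable
  exact h1.comp (hu.subtype_mk (h := hu01))

theorem IsCopulaDensity.setIntegral_cube {N : ℕ} {c : (Fin N → ℝ) → ℝ} (hc : IsCopulaDensity c)
    (i : Fin N) : ∫ v in Set.Icc (0 : Fin N → ℝ) 1, c v = 1 := by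
  have := hc.marginal i 1 ⟨zero_le_one, le_rfl⟩
  rwa [copulaCDF, show Function.update (1 : Fin N → ℝ) i 1 = 1 from Function.update_eq_self i 1]
    at this

/-- In one dimension the only continuous copula density is the constant `1`. -/
theorem IsCopulaDensity.eq_one_of_fin_one {c : (Fin 1 → ℝ) → ℝ} (hc : IsCopulaDensity c)
    (hcont : ContinuousOn c (Set.Icc 0 1)) {u : Fin 1 → ℝ} (hu : u ∈ Set.Icc (0 : Fin 1 → ℝ) 1) :
    c u = 1 := by
  have hcont' : ContinuousOn (fun t : ℝ => c (fun _ => t)) (Set.Icc 0 1) :=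
    hcont.comp (by fun_prop) fun t ht => ⟨fun _ => ht.1, fun _ => ht.2⟩
  have hint : ∀ t ∈ Set.Icc (0 : ℝ) 1, ∫ s in (0 : ℝ)..t, c (fun _ => s) = t := by
    intro t ht
    have h1 := hc.marginal 0 t ht
    rw [copulaCDF] at h1
    have hset : Set.Icc (0 : Fin 1 → ℝ) (Function.update 1 0 t)
        = (MeasurableEquiv.funUnique (Fin 1) ℝ) ⁻¹' Set.Icc 0 t := by
      ext v
      simp [Set.mem_Icc, Pi.le_def, MeasurableEquiv.funUnique]
    have h2 := (volume_preserving_funUnique (Fin 1) ℝ).setIntegral_preimage_emb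
      (MeasurableEquiv.measurableEmbedding _) (fun s => c (fun _ => s)) (Set.Icc 0 t)
    rw [← hset] at h2
    have h3 : ∀ v : Fin 1 → ℝ, (fun _ => (MeasurableEquiv.funUnique (Fin 1) ℝ) v) = v := by
      intro v; ext i; rw [Subsingleton.elim i 0]; simp [MeasurableEquiv.funUnique]
    simp only [h3] at h2
    rw [intervalIntegral.integral_of_le ht.1, ← integral_Icc_eq_integral_Ioc, ← h2]
    convert h1
  -- Both sides are continuous on `[0,1]`, so it suffices to compare them in the interior.
  have hopen : Set.EqOn (fun t : ℝ => c (fun _ => t)) (fun _ => 1) (Set.Ioo 0 1) := by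
    intro t ht
    have hnhds : Set.Icc (0 : ℝ) 1 ∈ 𝓝 t := Icc_mem_nhds ht.1 ht.2
    have hd : HasDerivAt (fun t => ∫ s in (0 : ℝ)..t, c (fun _ => s)) (c fun _ => t) t := by
      refine intervalIntegral.integral_hasDerivAt_right ?_ ?_ (hcont'.continuousAt hnhds)
      · exact (hcont'.mono (by
          rw [Set.uIcc_of_le ht.1.le]; exact Set.Icc_subset_Icc_right ht.2.le)).intervalIntegrable
      · exact (hcont'.mono Set.Ioo_subset_Icc_self).stronglyMeasurableAtFilter isOpen_Ioo t ht
    have hd' : HasDerivAt (fun t => ∫ s in (0 : ℝ)..t, c (fun _ => s)) 1 t :=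
      (hasDerivAt_id t).congr_of_eventuallyEq (by
        filter_upwards [hnhds] with s hs using hint s hs)
    exact hd.unique hd'
  have hcl : Set.Icc (0 : ℝ) 1 ⊆ closure (Set.Ioo 0 1) := by rw [closure_Ioo zero_ne_one]
  have := hopen.of_subset_closure hcont' continuousOn_const Set.Ioo_subset_Icc_self hcl
    (show u 0 ∈ Set.Icc (0 : ℝ) 1 from ⟨hu.1 0, hu.2 0⟩)
  simp only at this
  rw [← this]
  congr 1
  ext i; rw [Subsingleton.elim i 0]

/-! ### Sklar's formula for densities -/

/-- The law `μ` has the density `c(F₁(x₁), …, F_N(x_N))` with respect to the product of its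
marginals `ν i`. -/
theorem IsCopulaOf.eq_withDensity {N : ℕ} {c : (Fin N → ℝ) → ℝ} {μ : Measure (Fin N → ℝ)}
    [IsProbabilityMeasure μ] (hμ : IsCopulaOf c μ) (hc : IsCopulaDensity c)
    (i₀ : Fin N) (ν : Fin N → Measure ℝ)
    [∀ i, IsProbabilityMeasure (ν i)] [∀ i, NullSingletonClass (ν i)]
    (hν : ∀ i t, margCDF μ i t = cdf (ν i) t) :
    μ = (Measure.pi ν).withDensity
      fun x => ENNReal.ofReal (c fun i => margCDF μ i (x i)) := by
  have hFm : ∀ i, Measurable (cdf (ν i)) := fun i => (continuous_cdf (ν i)).measurable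
  simp only [hν]
  set F : (Fin N → ℝ) → Fin N → ℝ := fun x i => cdf (ν i) (x i) with hF
  have hFmeas : Measurable F := measurable_pi_lambda _ fun i => (hFm i).comp (measurable_pi_apply i)
  have hF01 : ∀ x, F x ∈ Set.Icc (0 : Fin N → ℝ) 1 :=
    fun x => ⟨fun i => cdf_nonneg _ _, fun i => cdf_le_one _ _⟩
  have hmap : (Measure.pi ν).map F = volume.restrict (Set.Icc 0 1) := by
    have : ∀ i, SigmaFinite ((ν i).map (cdf (ν i))) := fun i => by
      rw [map_cdf_eq_uniform]; infer_instance
    rw [hF, Measure.pi_map_pi fun i => (hFm i).aemeasurable]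
    simp only [map_cdf_eq_uniform]
    rw [← Measure.restrict_pi_pi, ← volume_pi, Set.pi_univ_Icc]
    rfl
  have hset : ∀ u ∈ Set.Icc (0 : Fin N → ℝ) 1,
      ∫⁻ x in F ⁻¹' Set.Iic u, ENNReal.ofReal (c (F x)) ∂Measure.pi ν
        = ENNReal.ofReal (copulaCDF c u) := by
    intro u hu
    have hg : AEMeasurable (fun v => ENNReal.ofReal (c v))
        (((Measure.pi ν).map F).restrict (Set.Iic u)) := by
      rw [hmap]
      exact (hc.integrable.aestronglyMeasurable.aemeasurable.ennreal_ofReal).mono_measure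
        Measure.restrict_le_self
    have h1 := lintegral_map' (g := F) (f := fun v => ENNReal.ofReal (c v))
      (μ := (Measure.pi ν).restrict (F ⁻¹' Set.Iic u))
      (by rwa [← Measure.restrict_map hFmeas measurableSet_Iic]) hFmeas.aemeasurable
    rw [← h1, ← Measure.restrict_map hFmeas measurableSet_Iic, hmap,
      Measure.restrict_restrict measurableSet_Iic]
    have e : Set.Iic u ∩ Set.Icc 0 1 = Set.Icc 0 u := by
      ext v; simp only [Set.mem_inter_iff, Set.mem_Iic, Set.mem_Icc]
      exact ⟨fun h => ⟨h.2.1, h.1⟩, fun h => ⟨h.2, h.1, h.2.trans hu.2⟩⟩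
    have hsub : Set.Icc 0 u ⊆ Set.Icc (0 : Fin N → ℝ) 1 := Set.Icc_subset_Icc_right hu.2
    rw [e, copulaCDF, ofReal_integral_eq_lintegral_ofReal (hc.integrable.mono_set hsub)]
    exact (ae_restrict_mem measurableSet_Icc).mono fun v hv => hc.nonneg v (hsub hv)
  have hfin : IsFiniteMeasure ((Measure.pi ν).withDensity
      fun x => ENNReal.ofReal (c (F x))) := by
    refine isFiniteMeasure_withDensity ?_
    have := hset 1 ⟨zero_le_one, le_rfl⟩
    rw [show F ⁻¹' Set.Iic 1 = Set.univ from Set.eq_univ_of_forall fun x => (hF01 x).2,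
      setLIntegral_univ] at this
    rw [this]; exact ENNReal.ofReal_ne_top
  have hIic : ∀ x : Fin N → ℝ, μ (Set.Iic x) = (Measure.pi ν).withDensity
      (fun x => ENNReal.ofReal (c (F x))) (Set.Iic x) := by
    intro x
    rw [withDensity_apply _ measurableSet_Iic]
    -- The two sets differ only where some `Fᵢ` stays constant to the right of `x i`.
    have hae : Set.Iic x =ᵐ[Measure.pi ν] F ⁻¹' Set.Iic (F x) := by
      have hsub : Set.Iic x ⊆ F ⁻¹' Set.Iic (F x) := fun y hy i => monotone_cdf (ν i) (hy i)
      refine hsub.eventuallyLE.antisymm ?_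
      have : ∀ i, ∀ᵐ y ∂Measure.pi ν, cdf (ν i) (y i) ≤ cdf (ν i) (x i) → y i ≤ x i := by
        intro i
        have h0 : ∀ᵐ t ∂ν i, cdf (ν i) t ≤ cdf (ν i) (x i) → t ≤ x i := by
          rw [ae_iff]
          convert measure_cdf_le_diff_Iic (ν i) (x i) using 2
          ext t; simp
        exact (Measure.quasiMeasurePreserving_eval ν i).ae h0
      filter_upwards [ae_all_iff.2 this] with y hy hyF i
      exact hy i (hyF i)
    rw [setLIntegral_congr hae, hset _ (hF01 x), ← ofReal_measureReal (measure_ne_top _ _), hμ x]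
    simp only [hν, hF]
  refine ext_of_generate_finite (Set.pi Set.univ '' Set.pi Set.univ fun _ => Set.range Set.Iic)
    ?_ (IsPiSystem.pi fun _ => isPiSystem_Iic) ?_ ?_
  · rw [← generateFrom_pi_eq fun _ => ?_]
    · rw [← borel_eq_generateFrom_Iic ℝ]
    · refine ⟨fun n => Set.Iic (n : ℝ), fun n => ⟨n, rfl⟩, ?_⟩
      exact Set.eq_univ_of_forall fun x => Set.mem_iUnion.2 (exists_nat_ge x)
  · rintro _ ⟨s, hs, rfl⟩
    choose x hx using fun i => hs i (Set.mem_univ i)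
    have : Set.pi Set.univ s = Set.Iic x := by
      rw [← Set.pi_univ_Iic]; congr 1; ext1 i; exact (hx i).symm
    rw [this, hIic]
  · have h1 := hset 1 ⟨zero_le_one, le_rfl⟩
    rw [show F ⁻¹' Set.Iic 1 = Set.univ from Set.eq_univ_of_forall fun x => (hF01 x).2,
      setLIntegral_univ] at h1
    rw [withDensity_apply _ MeasurableSet.univ, setLIntegral_univ, h1, copulaCDF,
      hc.setIntegral_cube i₀]
    simp

/-- An expectation under `μ` is one under the product of the marginals, weighted by the copula
density. -/
theorem IsCopulaOf.integral_eq {N : ℕ} {c : (Fin N → ℝ) → ℝ} {μ : Measure (Fin N → ℝ)}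
    [IsProbabilityMeasure μ] (hμ : IsCopulaOf c μ) (hc : IsCopulaDensity c)
    (hcont : ContinuousOn c (Set.Icc 0 1)) (i₀ : Fin N) (ν : Fin N → Measure ℝ)
    [∀ i, IsProbabilityMeasure (ν i)] [∀ i, NullSingletonClass (ν i)]
    (hν : ∀ i t, margCDF μ i t = cdf (ν i) t) (h : (Fin N → ℝ) → ℝ) :
    ∫ x, h x ∂μ = ∫ x, h x * c (fun i => margCDF μ i (x i)) ∂Measure.pi ν := by
  have hm : Measurable fun x : Fin N → ℝ => fun i => margCDF μ i (x i) := by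
    simp only [hν]
    exact measurable_pi_lambda _ fun i =>
      (continuous_cdf (ν i)).measurable.comp (measurable_pi_apply i)
  have h01 : ∀ x : Fin N → ℝ, (fun i => margCDF μ i (x i)) ∈ Set.Icc (0 : Fin N → ℝ) 1 := by
    intro x
    simp only [hν]
    exact ⟨fun i => cdf_nonneg _ _, fun i => cdf_le_one _ _⟩
  have hcm := measurable_comp_cube hcont hm h01
  conv_lhs => rw [hμ.eq_withDensity hc i₀ ν hν]
  rw [integral_withDensity_eq_integral_toReal_smul hcm.ennreal_ofReal
    (Eventually.of_forall fun _ => ENNReal.ofReal_lt_top)]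
  refine integral_congr_ae (Eventually.of_forall fun x => ?_)
  simp only
  rw [ENNReal.toReal_ofReal (hc.nonneg _ (h01 x)), smul_eq_mul, mul_comm]

/-! ### Loaded states -/

theorem norm_sq_eq_integral {α : Type*} [MeasurableSpace α] {μ : Measure α} (v : Lp ℂ 2 μ) :
    ‖v‖ ^ 2 = ∫ x, ‖v x‖ ^ 2 ∂μ := by
  have h : inner ℂ v v = ((∫ x, ‖v x‖ ^ 2 ∂μ : ℝ) : ℂ) := by
    rw [L2.inner_def, ← integral_complex_ofReal]
    refine integral_congr_ae (Eventually.of_forall fun x => ?_)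
    simp only
    rw [inner_self_eq_norm_sq_to_K]
    push_cast; rfl
  rw [inner_self_eq_norm_sq_to_K] at h
  simp only [Complex.coe_algebraMap] at h
  exact_mod_cast h

theorem pi_withDensity_ofReal {N : ℕ} (f : Fin N → ℝ → ℝ)
    (h0 : ∀ i x, 0 ≤ f i x) (hint : ∀ i, Integrable (f i)) :
    Measure.pi (fun i => volume.withDensity fun x => ENNReal.ofReal (f i x))
      = (volume : Measure (Fin N → ℝ)).withDensity
          fun x => ENNReal.ofReal (∏ i, f i (x i)) := by
  have : ∀ i, IsFiniteMeasure ((volume : Measure ℝ).withDensity fun x => ENNReal.ofReal (f i x)) :=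
    fun i => isFiniteMeasure_withDensity_ofReal (hint i).2
  refine Measure.pi_eq fun s hs => ?_
  have hind : ∀ x : Fin N → ℝ,
      (Set.univ.pi s).indicator (fun x => ENNReal.ofReal (∏ i, f i (x i))) x
      = ENNReal.ofReal (∏ i, (s i).indicator (f i) (x i)) := by
    intro x
    by_cases hx : x ∈ Set.univ.pi s
    · rw [Set.indicator_of_mem hx]
      congr 1
      exact Finset.prod_congr rfl fun i _ => (Set.indicator_of_mem (hx i trivial) _).symm
    · rw [Set.indicator_of_notMem hx]
      simp only [Set.mem_univ_pi, not_forall] at hx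
      obtain ⟨i, hi⟩ := hx
      rw [Finset.prod_eq_zero (Finset.mem_univ i) (Set.indicator_of_notMem hi _),
        ENNReal.ofReal_zero]
  have hI : ∀ i, Integrable ((s i).indicator (f i)) := fun i => (hint i).indicator (hs i)
  have hI0 : ∀ i x, 0 ≤ (s i).indicator (f i) x := fun i x =>
    Set.indicator_nonneg (fun x _ => h0 i x) x
  rw [withDensity_apply _ (MeasurableSet.univ_pi hs),
    ← lintegral_indicator (MeasurableSet.univ_pi hs)]
  simp only [hind]
  have hprod : Integrable fun x : Fin N → ℝ => ∏ i, (s i).indicator (f i) (x i) :=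
    Integrable.fintype_prod hI
  rw [← ofReal_integral_eq_lintegral_ofReal hprod
    (Eventually.of_forall fun x => Finset.prod_nonneg fun i _ => hI0 i _),
    integral_fintype_prod_volume_eq_prod (fun i => (s i).indicator (f i)),
    ENNReal.ofReal_prod_of_nonneg fun i _ => integral_nonneg (hI0 i)]
  refine Finset.prod_congr rfl fun i _ => ?_
  rw [withDensity_apply _ (hs i), integral_indicator (hs i),
    ofReal_integral_eq_lintegral_ofReal (hint i).integrableOn (Eventually.of_forall (h0 i))]

/-- The law of the position of a register in the state `v`. -/
def posLaw (v : Reg) : Measure ℝ := volume.withDensity fun x => ENNReal.ofReal (‖v x‖ ^ 2)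

theorem integrable_norm_sq (v : Reg) : Integrable fun x => ‖v x‖ ^ 2 :=
  (memLp_two_iff_integrable_sq_norm (Lp.memLp v).1).1 (Lp.memLp v)

theorem isProbabilityMeasure_posLaw {v : Reg} (hv : ‖v‖ = 1) : IsProbabilityMeasure (posLaw v) := by
  refine ⟨?_⟩
  rw [posLaw, withDensity_apply _ MeasurableSet.univ, setLIntegral_univ,
    ← ofReal_integral_eq_lintegral_ofReal (integrable_norm_sq v)
      (Eventually.of_forall fun x => by positivity), ← norm_sq_eq_integral, hv]
  simp

/-- The probability of the outcome `1` after a controlled rotation of a product state is the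
expectation of `φ` under the product of the position laws. -/
theorem norm_sq_mulFun_sqrt_tensor {N : ℕ} (φ : (Fin N → ℝ) → ℝ) (hφ : Measurable φ)
    (hφ01 : ∀ x, φ x ∈ Set.Icc (0 : ℝ) 1) (g : Fin N → Reg) :
    ‖mulFun (fun x => √(φ x)) (tensor g)‖ ^ 2 = ∫ x, φ x ∂Measure.pi fun i => posLaw (g i) := by
  have hs : Measurable fun x => √(φ x) := hφ.sqrt
  have hsb : ∀ x, |√(φ x)| ≤ 1 := fun x => abs_sqrt_le_one (hφ01 x).2
  have hm : ∀ i, Measurable fun x => ‖g i x‖ ^ 2 := fun i =>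
    (Lp.stronglyMeasurable (g i)).measurable.norm.pow_const 2
  have hpm : Measurable fun x : Fin N → ℝ => ∏ i, ‖g i (x i)‖ ^ 2 :=
    Finset.measurable_prod _ fun i _ => (hm i).comp (measurable_pi_apply i)
  rw [norm_sq_eq_integral]
  simp only [posLaw]
  rw [pi_withDensity_ofReal (fun i x => ‖g i x‖ ^ 2) (fun i x => by positivity)
      fun i => integrable_norm_sq (g i),
    integral_withDensity_eq_integral_toReal_smul hpm.ennreal_ofReal
    (Eventually.of_forall fun _ => ENNReal.ofReal_lt_top)]
  refine integral_congr_ae ?_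
  filter_upwards [coeFn_mulFun hs hsb (tensor g), (memLp_tensor g).coeFn_toLp] with x h1 h2
  rw [h1, tensor, h2, norm_mul, mul_pow, Complex.norm_real, Real.norm_eq_abs, sq_abs,
    Real.sq_sqrt (hφ01 x).1, norm_prod, ← Finset.prod_pow,
    ENNReal.toReal_ofReal (Finset.prod_nonneg fun i _ => by positivity), smul_eq_mul, mul_comm]

theorem norm_tensor {N : ℕ} (g : Fin N → Reg) (hg : ∀ i, ‖g i‖ = 1) : ‖tensor g‖ = 1 := by
  have h : ‖tensor g‖ ^ 2 = 1 := by
    rw [norm_sq_eq_integral]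
    have : ∫ x, ‖tensor g x‖ ^ 2 = ∫ x : Fin N → ℝ, ∏ i, ‖g i (x i)‖ ^ 2 := by
      refine integral_congr_ae ?_
      filter_upwards [(memLp_tensor g).coeFn_toLp] with x h2
      rw [tensor, h2, norm_prod, Finset.prod_pow]
    rw [this, integral_fintype_prod_volume_eq_prod (fun i x => ‖g i x‖ ^ 2)]
    refine Finset.prod_eq_one fun i _ => ?_
    rw [← norm_sq_eq_integral, hg i]; norm_num
  nlinarith [norm_nonneg (tensor g)]

/-- Loading the registers of a list without repetitions changes exactly those factors of a product
state. -/
theorem loadAll_tensor {N : ℕ} {f : Fin N → ℝ → ℝ} (A : Loaders N f) (l : List (Fin N))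
    (hl : l.Nodup) (g : Fin N → Reg) :
    loadAll A.load l (tensor g) = tensor fun i => if i ∈ l then A.oracle i (g i) else g i := by
  induction l generalizing g with
  | nil => simp [loadAll]
  | cons i l ih =>
    have hi : i ∉ l := (List.nodup_cons.1 hl).1
    rw [loadAll, LinearIsometryEquiv.trans_apply, A.load_tensor, ih (List.nodup_cons.1 hl).2]
    congr 1
    funext j
    by_cases hj : j = i
    · subst hj; simp [hi]
    · simp [hj]

theorem posLaw_oracle {N : ℕ} {f : Fin N → ℝ → ℝ} {μ : Measure (Fin N → ℝ)}
    (hf : ∀ i, HasMargDensity μ i (f i)) (A : Loaders N f)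
    (i : Fin N) : posLaw (A.oracle i (A.zero i)) = μ.map fun x => x i := by
  rw [(hf i).law, posLaw]
  refine withDensity_congr_ae ?_
  filter_upwards [A.prepares i] with x hx
  rw [hx, Complex.norm_real, Real.norm_eq_abs, sq_abs, Real.sq_sqrt ((hf i).nonneg x)]

theorem norm_initial_state {N : ℕ} {f : Fin N → ℝ → ℝ} {μ : Measure (Fin N → ℝ)}
    [IsProbabilityMeasure μ] (hf : ∀ i, HasMargDensity μ i (f i)) (A : Loaders N f)
    (i : Fin N) : ‖A.zero i‖ = 1 := by
  rw [← LinearIsometryEquiv.norm_map (A.oracle i)]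
  have : IsProbabilityMeasure (μ.map fun x => x i) :=
    Measure.isProbabilityMeasure_map (measurable_pi_apply i).aemeasurable
  have h1 : (μ.map fun x => x i) Set.univ = 1 := measure_univ
  rw [← posLaw_oracle hf A, posLaw, withDensity_apply _ MeasurableSet.univ, setLIntegral_univ,
    ← ofReal_integral_eq_lintegral_ofReal (integrable_norm_sq _)
      (Eventually.of_forall fun x => by positivity), ← norm_sq_eq_integral,
      ENNReal.ofReal_eq_one] at h1
  nlinarith [norm_nonneg (A.oracle i (A.zero i))]

theorem norm_sq_loaded_all {N : ℕ} {f : Fin N → ℝ → ℝ} {μ : Measure (Fin N → ℝ)}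
    [IsProbabilityMeasure μ] (hf : ∀ i, HasMargDensity μ i (f i)) (A : Loaders N f)
    (φ : (Fin N → ℝ) → ℝ) (hφ : Measurable φ)
    (hφ01 : ∀ x, φ x ∈ Set.Icc (0 : ℝ) 1) :
    ‖mulFun (fun x => √(φ x)) (loadAll A.load (List.finRange N) (tensor A.zero))‖ ^ 2
      = ∫ x, φ x ∂Measure.pi fun i => μ.map fun x => x i := by
  rw [loadAll_tensor A _ (List.nodup_finRange N), norm_sq_mulFun_sqrt_tensor φ hφ hφ01]
  simp only [List.mem_finRange, if_true, posLaw_oracle hf A]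

/-- Loading one register suffices for a function of one coordinate, the other registers being left
in normalized states. -/
theorem norm_sq_loaded_one {N : ℕ} {f : Fin N → ℝ → ℝ} {μ : Measure (Fin N → ℝ)}
    [IsProbabilityMeasure μ] (hf : ∀ i, HasMargDensity μ i (f i)) (A : Loaders N f)
    (i : Fin N) (φ : ℝ → ℝ) (hφ : Measurable φ)
    (hφ01 : ∀ x, φ x ∈ Set.Icc (0 : ℝ) 1) :
    ‖mulFun (fun x => √(φ (x i))) (loadAll A.load [i] (tensor A.zero))‖ ^ 2
      = ∫ x, φ x ∂(μ.map fun x => x i) := by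
  rw [loadAll_tensor A _ (List.nodup_singleton i), norm_sq_mulFun_sqrt_tensor (fun x => φ (x i))
    (hφ.comp (measurable_pi_apply i)) fun x => hφ01 (x i)]
  have : ∀ j, IsProbabilityMeasure
      (posLaw (if j ∈ [i] then A.oracle j (A.zero j) else A.zero j)) := by
    intro j
    refine isProbabilityMeasure_posLaw ?_
    split_ifs
    · rw [LinearIsometryEquiv.norm_map, norm_initial_state hf A]
    · exact norm_initial_state hf A j
  rw [integral_comp_eval (μ := fun j => posLaw (if j ∈ [i] then A.oracle j (A.zero j)
    else A.zero j)) hφ.aestronglyMeasurable]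
  simp [posLaw_oracle hf A]

/-! ### Composition of algorithms -/

theorem Algorithm.prob_nonneg {N : ℕ} {K : Fin N → ℕ} (O : OracleSet N K) (S : Set ℝ)
    (P : Algorithm N K) : 0 ≤ P.prob O S := by
  induction P with
  | ret r => rw [Algorithm.prob]; split_ifs <;> norm_num
  | run d gates next ih =>
    rw [Algorithm.prob]
    exact Finset.sum_nonneg fun α _ => mul_nonneg (by positivity) (ih α)

theorem Algorithm.count_run_of_forall_eq_zero {N : ℕ} {K : Fin N → ℕ}
    (cnt : ∀ d, Gate N K d → ℕ) {d : ℕ} (gates : List (Gate N K d))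
    (next : Anc d → Algorithm N K) (h : ∀ α, (next α).count cnt = 0) :
    (Algorithm.run d gates next).count cnt = (gates.map (cnt d)).sum := by
  rw [Algorithm.count, Nat.add_eq_left, ← Nat.le_zero]
  exact Finset.sup_le fun α _ => (h α).le

open Classical in
theorem Algorithm.le_prob_run {N : ℕ} {K : Fin N → ℕ} (O : OracleSet N K) (S : Set ℝ) {d : ℕ}
    (gates : List (Gate N K d)) (next : Anc d → Algorithm N K) (bad : Anc d → Prop) {η q : ℝ}
    (hq : 0 ≤ q) (htot : ∑ α, ‖runCircuit O gates α‖ ^ 2 = 1)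
    (hbad : ∑ α with bad α, ‖runCircuit O gates α‖ ^ 2 ≤ η)
    (hnext : ∀ α, ¬ bad α → q ≤ (next α).prob O S) :
    (1 - η) * q ≤ (Algorithm.run d gates next).prob O S := by
  rw [Algorithm.prob]
  have h1 := Finset.sum_filter_add_sum_filter_not Finset.univ bad
    fun α => ‖runCircuit O gates α‖ ^ 2
  calc (1 - η) * q ≤ (∑ α with ¬ bad α, ‖runCircuit O gates α‖ ^ 2) * q :=
        mul_le_mul_of_nonneg_right (by linarith) hq
    _ = ∑ α with ¬ bad α, ‖runCircuit O gates α‖ ^ 2 * q := Finset.sum_mul _ _ _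
    _ ≤ ∑ α with ¬ bad α, ‖runCircuit O gates α‖ ^ 2 * (next α).prob O S :=
        Finset.sum_le_sum fun α hα => mul_le_mul_of_nonneg_left
          (hnext α (Finset.mem_filter.1 hα).2) (by positivity)
    _ ≤ _ := Finset.sum_le_sum_of_subset_of_nonneg (Finset.filter_subset _ _)
        fun α _ _ => mul_nonneg (by positivity) (Algorithm.prob_nonneg _ _ _)

/-- Run one circuit for each index in a list, record the estimates, and go on with all of them. -/
def estimateAll {N : ℕ} {K : Fin N → ℕ} {ι : Type*} [DecidableEq ι] {d : ι → ℕ}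
    (gates : ∀ p, List (Gate N K (d p))) (est : ∀ p, Anc (d p) → ℝ)
    (next : (ι → ℝ) → Algorithm N K) : List ι → (ι → ℝ) → Algorithm N K
  | [], v => next v
  | p :: l, v => .run (d p) (gates p) fun α =>
      estimateAll gates est next l (Function.update v p (est p α))

theorem count_estimateAll_le {N : ℕ} {K : Fin N → ℕ} {ι : Type*} [DecidableEq ι] {d : ι → ℕ}
    (gates : ∀ p, List (Gate N K (d p))) (est : ∀ p, Anc (d p) → ℝ)
    (next : (ι → ℝ) → Algorithm N K) (cnt : ∀ d, Gate N K d → ℕ) {s n : ℕ}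
    (hs : ∀ p, ((gates p).map (cnt (d p))).sum ≤ s) (hn : ∀ v, (next v).count cnt ≤ n)
    (l : List ι) (v : ι → ℝ) :
    (estimateAll gates est next l v).count cnt ≤ l.length * s + n := by
  induction l generalizing v with
  | nil => simpa [estimateAll] using hn v
  | cons p l ih =>
    rw [estimateAll, Algorithm.count, List.length_cons, add_mul, one_mul, add_right_comm,
      add_comm _ s]
    exact add_le_add (hs p) (Finset.sup_le fun α _ => ih _)

open Classical in
/-- All estimates are good with probability at least `(1 - η) ^ n`, if each of the `n` circuits
yields a good one except with probability `η`. -/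
theorem le_prob_estimateAll {N : ℕ} {K : Fin N → ℕ} {ι : Type*} [DecidableEq ι] {d : ι → ℕ}
    (gates : ∀ p, List (Gate N K (d p))) (est : ∀ p, Anc (d p) → ℝ)
    (next : (ι → ℝ) → Algorithm N K) (O : OracleSet N K) (S : Set ℝ) (good : ι → ℝ → Prop)
    {η q : ℝ} (hq : 0 ≤ q) (hη : η ≤ 1)
    (htot : ∀ p, ∑ α, ‖runCircuit O (gates p) α‖ ^ 2 = 1)
    (hbad : ∀ p, ∑ α with ¬ good p (est p α), ‖runCircuit O (gates p) α‖ ^ 2 ≤ η)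
    (hnext : ∀ v, (∀ p, good p (v p)) → q ≤ (next v).prob O S)
    (l : List ι) (v : ι → ℝ) (hv : ∀ p, p ∉ l → good p (v p)) :
    (1 - η) ^ l.length * q ≤ (estimateAll gates est next l v).prob O S := by
  induction l generalizing v with
  | nil => simpa [estimateAll] using hnext v fun p => hv p (by simp)
  | cons p l ih =>
    rw [estimateAll, List.length_cons, pow_succ', mul_assoc]
    refine Algorithm.le_prob_run O S (gates p) _ (fun α => ¬ good p (est p α))
      (mul_nonneg (pow_nonneg (by linarith) _) hq) (htot p) (by convert hbad p) fun α hα => ?_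
    refine ih _ fun p' hp' => ?_
    by_cases h : p' = p
    · subst h; simpa using hα
    · rw [Function.update_of_ne h]
      exact hv p' (by simp [h, hp'])

/-! ### Random guesses -/

/-- Without any query, one of `g` given numbers can be returned with probability `1 / g` each. -/
theorem exists_uniform_guess {N : ℕ} {K : Fin N → ℕ} (g : ℕ) (hg : 1 ≤ g) (val : ℕ → ℝ) :
    ∃ P : Algorithm N K,
      (∀ cnt : ∀ d, Gate N K d → ℕ, (∀ d V, cnt d (.anc V) = 0) → P.count cnt = 0) ∧
      ∀ (O : OracleSet N K) (S : Set ℝ), ‖O.init‖ = 1 → (∃ j < g, val j ∈ S) →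
        1 / (g : ℝ) ≤ P.prob O S := by
  obtain ⟨d, rfl⟩ : ∃ d, g = d + 1 := ⟨g - 1, by omega⟩
  have hpos : (0 : ℝ) < d + 1 := by positivity
  have hsq : ‖((√(d + 1 : ℝ) : ℝ) : ℂ)⁻¹‖ ^ 2 = 1 / (d + 1 : ℝ) := by
    rw [norm_inv, Complex.norm_real, inv_pow, Real.norm_eq_abs, sq_abs, Real.sq_sqrt hpos.le,
      one_div]
  obtain ⟨V, hV⟩ := exists_unitary_col ((false, 0) : Anc d)
    (fun α => if α.1 = false then ((√(d + 1 : ℝ) : ℝ) : ℂ)⁻¹ else 0) (by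
      rw [Fintype.sum_prod_type, Fintype.sum_bool]
      simp only [Bool.true_eq_false, if_false, if_true, hsq]
      simp [hpos.ne'])
  refine ⟨.run d [Gate.anc V] fun α => .ret (val α.2), fun cnt hcnt => ?_, ?_⟩
  · simp [Algorithm.count, hcnt]
  rintro O S hinit ⟨j, hj, hjS⟩
  rw [Algorithm.prob]
  have hrun : ∀ α, runCircuit O [Gate.anc V] α
      = (if α.1 = false then ((√(d + 1 : ℝ) : ℝ) : ℂ)⁻¹ else 0) • O.init := by
    intro α
    simp only [runCircuit, List.foldl_cons, List.foldl_nil, Gate.apply, smul_ite, smul_zero,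
      Finset.sum_ite_eq', Finset.mem_univ, if_true, hV]
  have h1 := Finset.single_le_sum
    (f := fun α : Anc d => ‖runCircuit O [Gate.anc V] α‖ ^ 2
      * (Algorithm.ret (val α.2) : Algorithm N K).prob O S)
    (fun α _ => mul_nonneg (by positivity) (Algorithm.prob_nonneg _ _ _))
    (Finset.mem_univ ((false, ⟨j, hj⟩) : Anc d))
  refine le_trans (le_of_eq ?_) h1
  simp only [hrun, Algorithm.prob, if_pos hjS, if_true, norm_smul, hinit, mul_one, hsq]
  push_cast; rfl

/-- The midpoints of `g` consecutive intervals of length `2δ` form a `δ`-net of their union. -/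
theorem exists_midpoint_near {g : ℕ} (hg : 1 ≤ g) {δ p e : ℝ} (hδ : 0 < δ)
    (h : |p - e| ≤ g * δ) : ∃ j < g, |e - g * δ + (2 * (j : ℕ) + 1) * δ - p| ≤ δ := by
  obtain ⟨h1, h2⟩ := abs_le.1 h
  set t := (p - e + g * δ) / (2 * δ) with ht
  have ht0 : 0 ≤ t := div_nonneg (by linarith) (by linarith)
  have htp : p = e - g * δ + 2 * δ * t := by rw [ht]; field_simp; ring
  have htg : t ≤ g := by rw [ht, div_le_iff₀ (by linarith)]; linarith
  have hfl := Nat.floor_le ht0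
  have hfl2 := Nat.lt_floor_add_one t
  rcases lt_or_ge ⌊t⌋₊ g with hlt | hge
  · refine ⟨⌊t⌋₊, hlt, ?_⟩
    rw [htp, abs_le]; constructor <;> nlinarith
  · refine ⟨g - 1, by omega, ?_⟩
    have : (g : ℝ) ≤ t := (Nat.cast_le.2 hge).trans hfl
    have htg' : t = g := le_antisymm htg this
    have hc : ((g - 1 : ℕ) : ℝ) = g - 1 := by push_cast [Nat.cast_sub hg]; ring
    rw [htp, htg', hc, abs_le]; constructor <;> nlinarith

/-! ### The payoff -/

theorem add_one_div_four_pow_le (m : ℕ) : ((m : ℝ) + 1) / 4 ^ m ≤ 1 / 2 ^ m := by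
  have h : ((m : ℝ) + 1) ≤ 2 ^ m := by
    exact_mod_cast (Nat.lt_two_pow_self (n := m))
  rw [div_le_div_iff₀ (by positivity) (by positivity), one_mul]
  calc ((m : ℝ) + 1) * 2 ^ m ≤ 2 ^ m * 2 ^ m := by gcongr
    _ = 4 ^ m := by rw [← mul_pow]; norm_num

theorem window_failure_le {L m : ℕ} {η : ℝ} (h : 2 ≤ L * η) :
    ((m : ℝ) + 1) / (L * η) ^ (2 * m) ≤ ((m : ℝ) + 1) / 4 ^ m := by
  have : (4 : ℝ) ^ m = 2 ^ (2 * m) := by rw [pow_mul]; norm_num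
  rw [this]
  gcongr

/-- Estimation of the amplitude of the payoff rotation up to `δ`, with success probability `(1 -
(m + 1) / 4^m) / g`: amplitude estimation up to `g δ`, followed by a random guess among `g`
numbers. The guess trades success probability for queries. If `g δ ≥ 1/2` nothing need be queried.
-/
theorem exists_payoff_estimation {N : ℕ} {K : Fin N → ℕ} (coef : ∀ i, Fin (K i) → ℝ) (g m : ℕ)
    (hg : 1 ≤ g) {δ M : ℝ} (hδ : 0 < δ) (hM : 0 ≤ M) :
    ∃ P : Algorithm N K, P.basisQueries = 0 ∧
      (P.payoffQueries : ℝ) ≤ 5 * (m + 1) / (g * δ) ∧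
      (P.loadQueries : ℝ) ≤ N * (5 * (m + 1) / (g * δ)) ∧
      ∀ (O : OracleSet N K) (p : ℝ), ‖O.init‖ = 1 → Measurable (O.payoffFun coef) →
        (∀ x, O.payoffFun coef x ∈ Set.Icc (0 : ℝ) 1) → p ∈ Set.Icc (0 : ℝ) 1 →
        p = ‖mulFun (fun x => √(O.payoffFun coef x))
          (loadAll O.load (List.finRange N) O.init)‖ ^ 2 →
        (1 - (m + 1) / 4 ^ m) * (1 / g) ≤ P.prob O {y | |y - M * p| ≤ M * δ} := by
  have hgpos : (0 : ℝ) < g := by exact_mod_cast hg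
  choose G hGcnt hGprob using fun e : ℝ => exists_uniform_guess (N := N) (K := K) g hg
    fun j => M * (e - g * δ + (2 * (j : ℕ) + 1) * δ)
  have hGsucc : ∀ (O : OracleSet N K) (p e : ℝ), ‖O.init‖ = 1 → |p - e| ≤ g * δ →
      1 / (g : ℝ) ≤ (G e).prob O {y | |y - M * p| ≤ M * δ} := by
    intro O p e hinit hpe
    refine hGprob e O _ hinit ?_
    obtain ⟨j, hj, hjp⟩ := exists_midpoint_near hg hδ hpe
    refine ⟨j, hj, ?_⟩
    rw [Set.mem_ofPred_eq, ← mul_sub, abs_mul, abs_of_nonneg hM]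
    exact mul_le_mul_of_nonneg_left hjp hM
  rcases le_or_gt (1 / 2) (g * δ) with hbig | hsmall
  · have hpos : 0 ≤ 5 * ((m : ℝ) + 1) / (g * δ) := by positivity
    refine ⟨G (1 / 2), hGcnt _ _ fun _ _ => rfl, ?_, ?_, ?_⟩
    · rw [Algorithm.payoffQueries, hGcnt _ _ fun _ _ => rfl]; simpa using hpos
    · rw [Algorithm.loadQueries, hGcnt _ _ fun _ _ => rfl]; push_cast; positivity
    · intro O p hinit _ _ hp _
      refine le_trans ?_ (hGsucc O p (1 / 2) hinit ?_)
      · refine mul_le_of_le_one_left (by positivity) ?_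
        have : (0 : ℝ) ≤ ((m : ℝ) + 1) / 4 ^ m := by positivity
        linarith
      · refine le_trans ?_ hbig
        rw [abs_le]; constructor <;> linarith [hp.1, hp.2]
  · have hgδ : 0 < g * δ := by positivity
    set L := ⌈2 / (g * δ)⌉₊ with hL
    have hL1 : 1 ≤ L := Nat.one_le_ceil_iff.2 (by positivity)
    have hL2 : 2 ≤ L * (g * δ) := by
      rw [← div_le_iff₀ hgδ]; exact Nat.le_ceil _
    have hL3 : (L : ℝ) ≤ 5 / 2 / (g * δ) := by
      have := (Nat.ceil_lt_add_one (show 0 ≤ 2 / (g * δ) by positivity)).le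
      refine this.trans ?_
      rw [div_add_one hgδ.ne']
      gcongr
      linarith
    obtain ⟨d, gates, est, hd, hcnt, hest⟩ := exists_amplitude_estimation L m hL1
      (List.finRange N) (fun d inv ctl => (Gate.rotPayoff coef inv ctl : Gate N K d))
    have hdle : ((2 * d + 1 : ℕ) : ℝ) ≤ 5 * (m + 1) / (g * δ) := by
      have h1 : ((2 * d + 1 : ℕ) : ℝ) ≤ 2 * ((m + 1) * L) := by
        have : 2 * d + 1 ≤ 2 * ((m + 1) * L) := by rw [← hd]; omega
        exact_mod_cast this
      refine h1.trans ?_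
      calc 2 * (((m : ℝ) + 1) * L) ≤ 2 * ((m + 1) * (5 / 2 / (g * δ))) := by gcongr
        _ = _ := by ring
    refine ⟨.run d gates fun α => G (est α), ?_, ?_, ?_, ?_⟩
    · rw [Algorithm.basisQueries, Algorithm.count_run_of_forall_eq_zero _ _ _ fun _ =>
        hGcnt _ _ fun _ _ => rfl, hcnt _ 0 0 (fun _ => rfl) (fun _ => rfl) (fun _ _ _ => rfl)
        fun _ _ => rfl]
      simp
    · rw [Algorithm.payoffQueries, Algorithm.count_run_of_forall_eq_zero _ _ _ fun _ =>
        hGcnt _ _ fun _ _ => rfl, hcnt _ 0 1 (fun _ => rfl) (fun _ => rfl) (fun _ _ _ => rfl)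
        fun _ _ => rfl]
      simpa using hdle
    · rw [Algorithm.loadQueries, Algorithm.count_run_of_forall_eq_zero _ _ _ fun _ =>
        hGcnt _ _ fun _ _ => rfl, hcnt _ 1 0 (fun _ => rfl) (fun _ => rfl) (fun _ _ _ => rfl)
        fun _ _ => rfl]
      rw [List.length_finRange, mul_one, add_zero, Nat.cast_mul, mul_comm]
      gcongr
    · intro O p hinit hφ hφ01 _ hp
      obtain ⟨htot, htail⟩ := hest O (O.payoffFun coef) hinit hφ hφ01 fun _ _ _ _ => rfl
      refine Algorithm.le_prob_run O _ gates _ _ (by positivity) htot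
        ((htail (g * δ) hgδ).trans (window_failure_le hL2)) fun α hα => ?_
      refine hGsucc O p _ hinit ?_
      rw [abs_sub_comm, hp]
      exact not_lt.1 hα

/-! ### Cosine series of a density -/

/-- With the prescribed number of terms the truncated series is accurate to `tol / (4L)`. For `ζ ≤
0` the bound is not positive, whatever value the real power takes. -/
theorem CosRate.bound_terms_le {r : CosRate} (hr : r.Valid) {L tol : ℝ} (hL : 0 < L)
    (htol : 0 < tol) : r.bound (r.terms L tol) ≤ tol / (4 * L) := by
  cases r with
  | algebraic m ζ =>
    have hm : 1 ≤ m := hr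
    simp only [CosRate.bound, CosRate.terms]
    set x := 4 * ζ * L / tol with hx
    set K := max 1 ⌈x ^ ((1 : ℝ) / m)⌉₊ with hK
    rcases le_or_gt ζ 0 with hζ | hζ
    · exact (mul_nonpos_of_nonpos_of_nonneg hζ (by positivity)).trans (by positivity)
    · have hxpos : 0 < x := by positivity
      have h1 : x ^ ((1 : ℝ) / m) ≤ K := (Nat.le_ceil _).trans (by
        exact_mod_cast le_max_right _ _)
      have h2 : x ≤ (K : ℝ) ^ m := by
        calc x = (x ^ ((1 : ℝ) / m)) ^ m := by
              rw [one_div, Real.rpow_inv_natCast_pow hxpos.le (by omega)]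
          _ ≤ _ := pow_le_pow_left₀ (Real.rpow_nonneg hxpos.le _) h1 m
      calc ζ * ((K : ℝ) ^ m)⁻¹ ≤ ζ * x⁻¹ :=
            mul_le_mul_of_nonneg_left (inv_anti₀ hxpos h2) hζ.le
        _ = tol / (4 * L) := by rw [hx]; field_simp
  | exponential ν ζ =>
    have hν : 0 < ν := hr
    simp only [CosRate.bound, CosRate.terms]
    set x := 4 * ζ * L / tol with hx
    set K := max 1 ⌈Real.log (x ^ ((1 : ℝ) / ν))⌉₊ with hK
    rcases le_or_gt ζ 0 with hζ | hζ
    · exact (mul_nonpos_of_nonpos_of_nonneg hζ (Real.exp_nonneg _)).trans (by positivity)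
    · have hxpos : 0 < x := by positivity
      have h1 : Real.log (x ^ ((1 : ℝ) / ν)) ≤ K := (Nat.le_ceil _).trans (by
        exact_mod_cast le_max_right _ _)
      rw [Real.log_rpow hxpos, one_div, inv_mul_le_iff₀ hν] at h1
      have h2 : Real.exp (-(ν * K)) ≤ x⁻¹ := by
        rw [Real.exp_neg]
        exact inv_anti₀ hxpos ((Real.log_le_iff_le_exp hxpos).1 h1)
      calc ζ * Real.exp (-(ν * K)) ≤ ζ * x⁻¹ := mul_le_mul_of_nonneg_left h2 hζ.le
        _ = tol / (4 * L) := by rw [hx]; field_simp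

theorem CosRate.one_le_terms (r : CosRate) (L tol : ℝ) : 1 ≤ r.terms L tol := by
  cases r <;> exact le_max_left _ _

theorem abs_cosBasis_le {a b : ℝ} (hab : a < b) (k : ℕ) (x : ℝ) :
    |cosBasis a b k x| ≤ √(2 / (b - a)) := by
  have hL : 0 < b - a := sub_pos.2 hab
  unfold cosBasis
  split_ifs
  · rw [abs_of_nonneg (by positivity), Real.sqrt_div zero_le_two]
    refine div_le_div_of_nonneg_right ?_ (Real.sqrt_nonneg _)
    exact Real.one_le_sqrt.2 one_le_two
  · rw [abs_mul, abs_of_nonneg (Real.sqrt_nonneg _)]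
    exact mul_le_of_le_one_right (Real.sqrt_nonneg _) (Real.abs_cos_le_one _)
  · rw [abs_zero]; exact Real.sqrt_nonneg _

theorem measurable_cosBasis (a b : ℝ) (k : ℕ) : Measurable (cosBasis a b k) := by
  unfold cosBasis
  refine Measurable.ite measurableSet_Icc ?_ measurable_const
  split_ifs <;> fun_prop

theorem sqrt_half_mul_sqrt_two_div {L : ℝ} (hL : 0 < L) : √(L / 2) * √(2 / L) = 1 := by
  rw [← Real.sqrt_mul (by positivity), show L / 2 * (2 / L) = 1 by field_simp, Real.sqrt_one]

theorem cosBasisPos_mem_Icc {a b : ℝ} (hab : a < b) (k : ℕ) (x : ℝ) :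
    cosBasisPos a b k x ∈ Set.Icc (0 : ℝ) 1 := by
  have h1 := mul_le_mul_of_nonneg_left (abs_cosBasis_le hab k x) (Real.sqrt_nonneg ((b - a) / 2))
  rw [sqrt_half_mul_sqrt_two_div (sub_pos.2 hab)] at h1
  nth_rw 1 [← abs_of_nonneg (Real.sqrt_nonneg ((b - a) / 2))] at h1
  rw [← abs_mul, abs_le] at h1
  unfold cosBasisPos
  constructor <;> linarith [h1.1, h1.2]

theorem measurable_cosBasisPos (a b : ℝ) (k : ℕ) : Measurable (cosBasisPos a b k) :=
  ((measurable_cosBasis a b k).const_mul _).const_add _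

theorem intervalIntegrable_cosBasis {a b : ℝ} (hab : a < b) (k : ℕ) (x y : ℝ) :
    IntervalIntegrable (cosBasis a b k) volume x y :=
  (intervalIntegrable_const (c := √(2 / (b - a)))).mono_fun
    (measurable_cosBasis a b k).aestronglyMeasurable (Eventually.of_forall fun t => by
      simp only
      rw [Real.norm_eq_abs, Real.norm_eq_abs, abs_of_nonneg (Real.sqrt_nonneg _)]
      exact abs_cosBasis_le hab k t)

theorem integrable_of_withDensity {f : ℝ → ℝ} {ν : Measure ℝ} [IsProbabilityMeasure ν]
    (hf : Measurable f) (hf0 : ∀ x, 0 ≤ f x)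
    (hν : ν = volume.withDensity fun x => ENNReal.ofReal (f x)) : Integrable f := by
  refine ⟨hf.aestronglyMeasurable, ?_⟩
  rw [hasFiniteIntegral_iff_ofReal (Eventually.of_forall hf0)]
  have : ν Set.univ < ⊤ := measure_lt_top _ _
  rwa [hν, withDensity_apply _ MeasurableSet.univ, setLIntegral_univ] at this

/-- The flip probability of a `W_{γ_k}` rotation determines the `k`-th cosine coefficient; outside
`[a,b]` the basis function vanishes, so no mass is lost. -/
theorem integral_cosBasisPos {f : ℝ → ℝ} {ν : Measure ℝ} [IsProbabilityMeasure ν]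
    (hf : Measurable f) (hf0 : ∀ x, 0 ≤ f x)
    (hν : ν = volume.withDensity fun x => ENNReal.ofReal (f x)) {a b : ℝ} (hab : a < b) (k : ℕ) :
    ∫ x, cosBasisPos a b k x ∂ν = 1 / 2 + 1 / 2 * √((b - a) / 2) * cosCoeff a b f k := by
  have hint : Integrable (cosBasis a b k) ν :=
    (integrable_const (√(2 / (b - a)))).mono (measurable_cosBasis a b k).aestronglyMeasurable
      (Eventually.of_forall fun t => by
        rw [Real.norm_eq_abs, Real.norm_eq_abs, abs_of_nonneg (Real.sqrt_nonneg _)]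
        exact abs_cosBasis_le hab k t)
  unfold cosBasisPos
  rw [integral_add (integrable_const _) (hint.const_mul _), integral_const, integral_const_mul]
  simp only [probReal_univ, smul_eq_mul, one_mul]
  congr 2
  rw [hν, integral_withDensity_eq_integral_toReal_smul hf.ennreal_ofReal
    (Eventually.of_forall fun _ => ENNReal.ofReal_lt_top), cosCoeff,
    intervalIntegral.integral_of_le hab.le, ← integral_Icc_eq_integral_Ioc,
    ← integral_indicator measurableSet_Icc]
  refine integral_congr_ae (Eventually.of_forall fun x => ?_)
  simp only
  rw [ENNReal.toReal_ofReal (hf0 x), smul_eq_mul]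
  by_cases hx : x ∈ Set.Icc a b
  · rw [Set.indicator_of_mem hx]
  · rw [Set.indicator_of_notMem hx, cosBasis, if_neg hx, mul_zero]

theorem cdf_sub_cdf_eq_integral {f : ℝ → ℝ} {ν : Measure ℝ} [IsProbabilityMeasure ν]
    (hf : Measurable f) (hf0 : ∀ x, 0 ≤ f x)
    (hν : ν = volume.withDensity fun x => ENNReal.ofReal (f x)) {a x : ℝ} (hax : a ≤ x) :
    cdf ν x - cdf ν a = ∫ t in a..x, f t := by
  have hint := integrable_of_withDensity hf hf0 hν
  rw [cdf_eq_real, cdf_eq_real, ← measureReal_sdiff (Set.Iic_subset_Iic.2 hax) measurableSet_Iic,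
    Set.Iic_sdiff_Iic, intervalIntegral.integral_of_le hax, measureReal_def, hν,
    withDensity_apply _ measurableSet_Ioc,
    ← ofReal_integral_eq_lintegral_ofReal hint.integrableOn (Eventually.of_forall hf0),
    ENNReal.toReal_ofReal (integral_nonneg hf0)]

theorem abs_clip_sub_le {s t : ℝ} (ht0 : 0 ≤ t) (ht1 : t ≤ 1) :
    |max 0 (min 1 s) - t| ≤ |s - t| := by
  rcases le_total s 0 with h | h
  · rw [min_eq_right (h.trans zero_le_one), max_eq_left h, abs_of_nonpos (by linarith),
      abs_of_nonpos (by linarith)]; linarith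
  · rcases le_total s 1 with h1 | h1
    · rw [min_eq_right h1, max_eq_right h]
    · rw [min_eq_left h1, max_eq_right zero_le_one, abs_of_nonneg (by linarith),
        abs_of_nonneg (by linarith)]; linarith

theorem cosCDF_mem_Icc (a b : ℝ) {K : ℕ} (coef : Fin K → ℝ) (x : ℝ) :
    cosCDF a b coef x ∈ Set.Icc (0 : ℝ) 1 := by
  unfold cosCDF
  split_ifs
  · simp
  · exact ⟨le_max_left _ _, max_le zero_le_one (min_le_left _ _)⟩
  · simp

theorem measurable_cosCDF {a b : ℝ} (hab : a < b) {K : ℕ} (coef : Fin K → ℝ) :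
    Measurable (cosCDF a b coef) := by
  have hc : ∀ k : ℕ, Measurable fun x => ∫ t in a..x, cosBasis a b k t := fun k =>
    (intervalIntegral.continuous_primitive (intervalIntegrable_cosBasis hab k) a).measurable
  unfold cosCDF
  refine Measurable.ite measurableSet_Iio measurable_const
    (Measurable.ite measurableSet_Iio ?_ measurable_const)
  exact measurable_const.max (measurable_const.min
    (Finset.measurable_sum _ fun k _ => (hc k).const_mul _))

/-- The distribution function rebuilt from coefficients whose amplitudes are known up to `η`. The
three contributions to the error are the mass left of `a`, the truncation of the cosine series, and
the errors of the coefficients. -/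
theorem abs_cosCDF_sub_cdf_le {f : ℝ → ℝ} {ν : Measure ℝ} [IsProbabilityMeasure ν]
    (hf : Measurable f) (hf0 : ∀ x, 0 ≤ f x)
    (hν : ν = volume.withDensity fun x => ENNReal.ofReal (f x)) {a b : ℝ} (hab : a < b)
    {K : ℕ} {tol η B : ℝ} (htol : 0 < tol)
    (hB : ∀ x ∈ Set.Icc a b, |cosPartialSum a b f K x - f x| ≤ B) (hBtol : B ≤ tol / (4 * (b - a)))
    (ha : cdf ν a ≤ tol / 2) (hb : 1 - tol ≤ cdf ν b) (e : Fin K → ℝ)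
    (he : ∀ k, |e k - ∫ x, cosBasisPos a b k x ∂ν| ≤ η) (hη : 4 * (K * η) ≤ tol / 4) (x : ℝ) :
    |cosCDF a b (fun k => √(2 / (b - a)) * (2 * e k - 1)) x - cdf ν x| ≤ tol := by
  have hL : 0 < b - a := sub_pos.2 hab
  have hF0 := cdf_nonneg ν x
  have hF1 := cdf_le_one ν x
  unfold cosCDF
  split_ifs with h1 h2
  · have := monotone_cdf ν h1.le
    rw [abs_le]; constructor <;> linarith
  · push Not at h1
    refine (abs_clip_sub_le hF0 hF1).trans ?_
    have hfint : IntervalIntegrable f volume a x :=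
      (integrable_of_withDensity hf hf0 hν).intervalIntegrable
    have hPint : IntervalIntegrable (cosPartialSum a b f K) volume a x := by
      have : cosPartialSum a b f K
          = ∑ k ∈ Finset.range K, fun x => cosCoeff a b f k * cosBasis a b k x := by
        ext; simp [cosPartialSum]
      rw [this]
      exact IntervalIntegrable.sum _ fun k _ => (intervalIntegrable_cosBasis hab k a x).const_mul _
    have hFx := cdf_sub_cdf_eq_integral hf hf0 hν h1
    have hsum : ∑ k : Fin K, cosCoeff a b f k * ∫ t in a..x, cosBasis a b k t
        = ∫ t in a..x, cosPartialSum a b f K t := by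
      unfold cosPartialSum
      rw [intervalIntegral.integral_finsetSum fun k _ =>
        (intervalIntegrable_cosBasis hab k a x).const_mul _,
        Fin.sum_univ_eq_sum_range (fun k => cosCoeff a b f k * ∫ t in a..x, cosBasis a b k t) K]
      simp [intervalIntegral.integral_const_mul]
    have htrunc : |(∫ t in a..x, cosPartialSum a b f K t) - ∫ t in a..x, f t| ≤ tol / 4 := by
      rw [← intervalIntegral.integral_sub hPint hfint]
      have h3 := intervalIntegral.norm_integral_le_of_norm_le_const (a := a) (b := x)
        (C := tol / (4 * (b - a))) (f := fun t => cosPartialSum a b f K t - f t) fun t ht => by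
          rw [Set.uIoc_of_le h1] at ht
          exact (hB t ⟨ht.1.le, ht.2.trans h2.le⟩).trans hBtol
      refine h3.trans ?_
      rw [abs_of_nonneg (by linarith)]
      calc tol / (4 * (b - a)) * (x - a) ≤ tol / (4 * (b - a)) * (b - a) := by gcongr
        _ = tol / 4 := by field_simp
    have hcoef : ∀ k : Fin K, |(√(2 / (b - a)) * (2 * e k - 1) - cosCoeff a b f k)
        * ∫ t in a..x, cosBasis a b k t| ≤ 4 * η := by
      intro k
      have hsq := sqrt_half_mul_sqrt_two_div hL
      have e1 : √(2 / (b - a)) * (2 * e k - 1) - cosCoeff a b f k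
          = 2 * √(2 / (b - a)) * (e k - ∫ x, cosBasisPos a b k x ∂ν) := by
        rw [integral_cosBasisPos hf hf0 hν hab]
        linear_combination (cosCoeff a b f k) * hsq
      have e2 : |∫ t in a..x, cosBasis a b k t| ≤ √(2 / (b - a)) * (b - a) := by
        have h3 := intervalIntegral.norm_integral_le_of_norm_le_const (a := a) (b := x)
          (C := √(2 / (b - a))) (f := cosBasis a b k) fun t _ => abs_cosBasis_le hab k t
        refine h3.trans ?_
        rw [abs_of_nonneg (by linarith)]
        gcongr
      have e3 : √(2 / (b - a)) * √(2 / (b - a)) = 2 / (b - a) := Real.mul_self_sqrt (by positivity)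
      rw [e1, abs_mul, abs_mul, abs_of_nonneg (by positivity : 0 ≤ 2 * √(2 / (b - a)))]
      calc 2 * √(2 / (b - a)) * |e k - ∫ x, cosBasisPos a b k x ∂ν|
            * |∫ t in a..x, cosBasis a b k t|
          ≤ 2 * √(2 / (b - a)) * η * (√(2 / (b - a)) * (b - a)) :=
            mul_le_mul (mul_le_mul_of_nonneg_left (he k) (by positivity)) e2 (abs_nonneg _)
              (mul_nonneg (by positivity) ((abs_nonneg _).trans (he k)))
        _ = 2 * (√(2 / (b - a)) * √(2 / (b - a))) * (b - a) * η := by ring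
        _ = 4 * η := by rw [e3]; field_simp; ring
    have hest : |(∑ k : Fin K, √(2 / (b - a)) * (2 * e k - 1) * ∫ t in a..x, cosBasis a b k t)
        - ∑ k : Fin K, cosCoeff a b f k * ∫ t in a..x, cosBasis a b k t| ≤ tol / 4 := by
      rw [← Finset.sum_sub_distrib]
      simp only [← sub_mul]
      calc _ ≤ ∑ k : Fin K, 4 * η := (Finset.abs_sum_le_sum_abs _ _).trans
            (Finset.sum_le_sum fun k _ => hcoef k)
        _ = 4 * (K * η) := by simp; ring
        _ ≤ _ := hη
    rw [hsum] at hest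
    have hFa := cdf_nonneg ν a
    have t1 := abs_le.1 hest
    have t2 := abs_le.1 htrunc
    simp only
    rw [abs_le]; constructor <;> linarith [t1.1, t1.2, t2.1, t2.2]
  · push Not at h2
    have := monotone_cdf ν h2
    rw [abs_le]; constructor <;> linarith

/-! ### The price as an amplitude -/

theorem adjustedPayoff_mem_Icc {N : ℕ} {K : Fin N → ℕ} {a b : Fin N → ℝ}
    {h c : (Fin N → ℝ) → ℝ} {cmax : ℝ} (hcmax : 0 < cmax) (hc : IsCopulaDensity c)
    (hgr : IsGreatest (c '' Set.Icc 0 1) cmax) (hh : ∀ x, h x ∈ Set.Icc (0 : ℝ) 1)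
    (coef : ∀ i, Fin (K i) → ℝ) (x : Fin N → ℝ) :
    adjustedPayoff a b h c cmax coef x ∈ Set.Icc (0 : ℝ) 1 := by
  have hu : (fun i => cosCDF (a i) (b i) (coef i) (x i)) ∈ Set.Icc (0 : Fin N → ℝ) 1 :=
    ⟨fun i => (cosCDF_mem_Icc _ _ _ _).1, fun i => (cosCDF_mem_Icc _ _ _ _).2⟩
  have h0 := hc.nonneg _ hu
  have h1 : c (fun i => cosCDF (a i) (b i) (coef i) (x i)) ≤ cmax := hgr.2 ⟨_, hu, rfl⟩
  have hx := hh x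
  unfold adjustedPayoff
  constructor
  · have := hx.1; positivity
  · rw [mul_assoc, one_div_mul_eq_div, div_le_one hcmax]
    exact (mul_le_of_le_one_left h0 hx.2).trans h1

theorem measurable_adjustedPayoff {N : ℕ} {K : Fin N → ℕ} {a b : Fin N → ℝ} (hab : ∀ i, a i < b i)
    {h c : (Fin N → ℝ) → ℝ} {cmax : ℝ} (hcont : ContinuousOn c (Set.Icc 0 1)) (hh : Measurable h)
    (coef : ∀ i, Fin (K i) → ℝ) : Measurable (adjustedPayoff a b h c cmax coef) := by
  unfold adjustedPayoff
  refine (hh.const_mul _).mul (measurable_comp_cube hcont ?_ fun x =>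
    ⟨fun i => (cosCDF_mem_Icc _ _ _ _).1, fun i => (cosCDF_mem_Icc _ _ _ _).2⟩)
  exact measurable_pi_lambda _ fun i =>
    (measurable_cosCDF (hab i) (coef i)).comp (measurable_pi_apply i)

theorem abs_cmax_mul_integral_adjustedPayoff_sub_le {N : ℕ} {K : Fin N → ℕ} {a b : Fin N → ℝ}
    (hab : ∀ i, a i < b i) {h c : (Fin N → ℝ) → ℝ} {cmax : ℝ} (hcmax : 0 < cmax)
    (hc : IsCopulaDensity c) (hcont : ContinuousOn c (Set.Icc 0 1))
    (hgr : IsGreatest (c '' Set.Icc 0 1) cmax) (hh : Measurable h)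
    (hh01 : ∀ x, h x ∈ Set.Icc (0 : ℝ) 1) {μ : Measure (Fin N → ℝ)} [IsProbabilityMeasure μ]
    (hμ : IsCopulaOf c μ) (i₀ : Fin N) (ν : Fin N → Measure ℝ) [∀ i, IsProbabilityMeasure (ν i)]
    [∀ i, NullSingletonClass (ν i)] (hν : ∀ i t, margCDF μ i t = cdf (ν i) t)
    (coef : ∀ i, Fin (K i) → ℝ) {δ : ℝ}
    (hδ : ∀ x : Fin N → ℝ, |c (fun i => cosCDF (a i) (b i) (coef i) (x i))
      - c (fun i => margCDF μ i (x i))| ≤ δ) :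
    |cmax * ∫ x, adjustedPayoff a b h c cmax coef x ∂Measure.pi ν - ∫ x, h x ∂μ| ≤ δ := by
  have hF01 : ∀ x : Fin N → ℝ, (fun i => margCDF μ i (x i)) ∈ Set.Icc (0 : Fin N → ℝ) 1 := by
    intro x
    simp only [hν]
    exact ⟨fun i => cdf_nonneg _ _, fun i => cdf_le_one _ _⟩
  have hFm : Measurable fun x : Fin N → ℝ => fun i => margCDF μ i (x i) := by
    simp only [hν]
    exact measurable_pi_lambda _ fun i =>
      (continuous_cdf (ν i)).measurable.comp (measurable_pi_apply i)
  have hi1 : Integrable (fun x => cmax * adjustedPayoff a b h c cmax coef x) (Measure.pi ν) := by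
    refine (Integrable.of_bound (measurable_adjustedPayoff hab hcont hh coef).aestronglyMeasurable
      1 (Eventually.of_forall fun x => ?_)).const_mul _
    have := adjustedPayoff_mem_Icc (a := a) (b := b) hcmax hc hgr hh01 coef x
    rw [Real.norm_eq_abs, abs_of_nonneg this.1]; exact this.2
  have hi2 : Integrable (fun x => h x * c (fun i => margCDF μ i (x i))) (Measure.pi ν) := by
    refine Integrable.of_bound
      (hh.mul (measurable_comp_cube hcont hFm hF01)).aestronglyMeasurable cmax
      (Eventually.of_forall fun x => ?_)
    have h0 := hc.nonneg _ (hF01 x)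
    have h1 : c (fun i => margCDF μ i (x i)) ≤ cmax := hgr.2 ⟨_, hF01 x, rfl⟩
    rw [Real.norm_eq_abs, abs_of_nonneg (mul_nonneg (hh01 x).1 h0)]
    exact (mul_le_of_le_one_left h0 (hh01 x).2).trans h1
  rw [hμ.integral_eq hc hcont i₀ ν hν, ← integral_const_mul, ← integral_sub hi1 hi2,
    ← Real.norm_eq_abs]
  refine (norm_integral_le_of_norm_le_const (C := δ) (Eventually.of_forall fun x => ?_)).trans
    (by simp)
  have e : cmax * adjustedPayoff a b h c cmax coef x - h x * c (fun i => margCDF μ i (x i))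
      = h x * (c (fun i => cosCDF (a i) (b i) (coef i) (x i))
        - c (fun i => margCDF μ i (x i))) := by
    unfold adjustedPayoff
    field_simp
  rw [Real.norm_eq_abs, e, abs_mul, abs_of_nonneg (hh01 x).1]
  exact (mul_le_of_le_one_left (abs_nonneg _) (hh01 x).2).trans (hδ x)

/-! ### Choice of parameters -/

/-- The window order needed for a failure probability `1 / (4x)` is logarithmic in `x`. -/
theorem exists_window_order {x : ℝ} (hx : 2 ≤ x) :
    ∃ m : ℕ, ((m : ℝ) + 1) / 4 ^ m ≤ 1 / (4 * x) ∧ (m : ℝ) + 1 ≤ 8 * Real.log x := by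
  have hxpos : 0 < x := by linarith
  have hlog2 := Real.log_two_gt_d9
  have hlogx : Real.log 2 ≤ Real.log x := Real.log_le_log two_pos hx
  have hl2 : 0 < Real.log 2 := by linarith
  have hl4 : Real.log (4 * x) = 2 * Real.log 2 + Real.log x := by
    rw [Real.log_mul (by norm_num) hxpos.ne', show (4 : ℝ) = 2 ^ 2 by norm_num, Real.log_pow]
    push_cast; ring
  set m := ⌈Real.log (4 * x) / Real.log 2⌉₊ with hm
  refine ⟨m, (add_one_div_four_pow_le m).trans ?_, ?_⟩
  · refine one_div_le_one_div_of_le (by positivity) ?_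
    rw [← Real.log_le_log_iff (by positivity) (by positivity), Real.log_pow, ← div_le_iff₀ hl2]
    exact Nat.le_ceil _
  · have h1 := (Nat.ceil_lt_add_one (show 0 ≤ Real.log (4 * x) / Real.log 2 from
      div_nonneg (by rw [hl4]; linarith) hl2.le)).le
    have h2 : Real.log (4 * x) / Real.log 2 ≤ 8 * Real.log x - 2 := by
      rw [div_le_iff₀ hl2, hl4]
      nlinarith
    linarith

/-- The number `g` of guesses and the order `m` of the window for the payoff. For `ρ < 1/2` no guess
is needed. For `ρ ≥ 1/2` the required success probability `1 - ρ` may be small, and so is the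
permitted number of queries; `g` is then of order `1 / (1 - ρ)`. -/
theorem exists_guess_window {M ε ρ : ℝ} (hM : 0 < M) (hε : 0 < ε) (hρ : ρ ∈ Set.Ioo (0 : ℝ) 1) :
    ∃ g m : ℕ, 1 ≤ g ∧
      5 * ((m : ℝ) + 1) / (g * (ε / (2 * M))) ≤ 120 * (M / ε * Real.log (1 / ρ)) ∧
      1 - ρ ≤ (1 - ρ / 4) * ((1 - ((m : ℝ) + 1) / 4 ^ m) * (1 / g)) := by
  obtain ⟨h0, h1⟩ := hρ
  rcases lt_or_ge ρ (1 / 2) with h | h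
  · obtain ⟨m, hm1, hm2⟩ := exists_window_order (x := 1 / ρ) (by
      rw [le_div_iff₀ h0]; linarith)
    refine ⟨1, m, le_rfl, ?_, ?_⟩
    · have e : 5 * ((m : ℝ) + 1) / ((1 : ℕ) * (ε / (2 * M))) = 10 * (M / ε) * ((m : ℝ) + 1) := by
        push_cast; field_simp; ring
      rw [e]
      calc 10 * (M / ε) * ((m : ℝ) + 1) ≤ 10 * (M / ε) * (8 * Real.log (1 / ρ)) := by gcongr
        _ = 80 * (M / ε * Real.log (1 / ρ)) := by ring
        _ ≤ _ := by
          refine mul_le_mul_of_nonneg_right (by norm_num) ?_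
          have : 0 ≤ Real.log (1 / ρ) := Real.log_nonneg ((one_le_div h0).2 h1.le)
          positivity
    · have e : 1 / (4 * (1 / ρ)) = ρ / 4 := by field_simp
      rw [e] at hm1
      push_cast
      nlinarith
  · set δ := 1 - ρ with hδ
    have hδ0 : 0 < δ := by linarith
    set x := 45 / (64 * δ) with hx
    have hx1 : 1 ≤ x := by rw [hx, le_div_iff₀ (by positivity)]; linarith
    set g := ⌊x⌋₊ with hg
    have hg1 : 1 ≤ g := Nat.one_le_floor_iff x |>.2 hx1
    have hg1' : (1 : ℝ) ≤ g := by exact_mod_cast hg1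
    have hgx : (g : ℝ) ≤ x := Nat.floor_le (by linarith)
    have hgx2 : x ≤ 2 * g := by linarith [Nat.lt_floor_add_one x]
    have hlog : δ ≤ Real.log (1 / ρ) := by
      rw [one_div, Real.log_inv]
      linarith [Real.log_le_sub_one_of_pos h0]
    refine ⟨g, 3, hg1, ?_, ?_⟩
    · have hgi : 1 / (g : ℝ) ≤ 128 / 45 * δ := by
        rw [div_le_iff₀ (by linarith)]
        have : x * δ = 45 / 64 := by rw [hx]; field_simp
        nlinarith
      have e : 5 * (((3 : ℕ) : ℝ) + 1) / (g * (ε / (2 * M))) = 40 * (M / ε) * (1 / g) := by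
        push_cast; field_simp; ring
      rw [e]
      calc 40 * (M / ε) * (1 / g) ≤ 40 * (M / ε) * (128 / 45 * δ) := by gcongr
        _ ≤ 40 * (M / ε) * (3 * Real.log (1 / ρ)) := by
            gcongr
            linarith
        _ = _ := by ring
    -- `45 / 64` is a bound `3 / 4` for the success of all coefficients times `15 / 16`, that for a
    -- window of order `3`.
    · have hgδ : δ * g ≤ 45 / 64 := by
        have : x * δ = 45 / 64 := by rw [hx]; field_simp
        nlinarith
      have h2 : δ ≤ 45 / 64 * (1 / g) := by
        rw [mul_one_div, le_div_iff₀ (by linarith)]; exact hgδ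
      refine h2.trans ?_
      have h3 : 0 ≤ 1 / (g : ℝ) := by positivity
      have h4 : 1 - (((3 : ℕ) : ℝ) + 1) / 4 ^ 3 = 15 / 16 := by norm_num
      rw [h4]
      nlinarith

theorem Algorithm.prob_mono {N : ℕ} {K : Fin N → ℕ} (O : OracleSet N K) {S T : Set ℝ} (h : S ⊆ T)
    (P : Algorithm N K) : P.prob O S ≤ P.prob O T := by
  induction P with
  | ret r =>
    rw [Algorithm.prob, Algorithm.prob]
    by_cases hS : r ∈ S
    · rw [if_pos hS, if_pos (h hS)]
    · rw [if_neg hS]; split_ifs <;> norm_num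
  | run d gates next ih =>
    rw [Algorithm.prob, Algorithm.prob]
    exact Finset.sum_le_sum fun α _ => mul_le_mul_of_nonneg_left (ih α) (by positivity)

open Classical in
/-- Estimation of one cosine coefficient: `γ_k⁺` has to be found up to `tol / (16 κ)`. -/
theorem exists_coefficient_estimation {N : ℕ} {K : Fin N → ℕ} (i : Fin N) (k : Fin (K i))
    {tol κ x : ℝ} (htol : 0 < tol) (htol1 : tol ≤ 1) (hκ : 1 ≤ κ) (hx : 2 ≤ x) :
    ∃ (d : ℕ) (gates : List (Gate N K d)) (est : Anc d → ℝ) (s : ℕ),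
      (s : ℝ) ≤ 528 * Real.log x * κ / tol ∧
      (∀ (cnt : Gate N K d → ℕ) (p q : ℕ), (∀ V, cnt (.anc V) = 0) →
        (∀ V, cnt (.ancIfZero V) = 0) → (∀ i inv ctl, cnt (.load i inv ctl) = p) →
        (∀ inv ctl, cnt (.rotBasis i k inv ctl) = q) → (gates.map cnt).sum = s * (p + q)) ∧
      ∀ O : OracleSet N K, ‖O.init‖ = 1 → Measurable (O.basisFun i k) →
        (∀ x, O.basisFun i k x ∈ Set.Icc (0 : ℝ) 1) →
        ∑ α, ‖runCircuit O gates α‖ ^ 2 = 1 ∧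
          ∑ α with tol / (16 * κ) < |est α
              - ‖mulFun (fun x => √(O.basisFun i k x)) (loadAll O.load [i] O.init)‖ ^ 2|,
            ‖runCircuit O gates α‖ ^ 2 ≤ 1 / (4 * x) := by
  obtain ⟨m, hm1, hm2⟩ := exists_window_order hx
  have hη : 0 < tol / (16 * κ) := by positivity
  set L := ⌈2 / (tol / (16 * κ))⌉₊ with hL
  have hL1 : 1 ≤ L := Nat.one_le_ceil_iff.2 (by positivity)
  have hL2 : 2 ≤ L * (tol / (16 * κ)) := by
    rw [← div_le_iff₀ hη]; exact Nat.le_ceil _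
  have hL3 : (L : ℝ) ≤ 33 * κ / tol := by
    refine (Nat.ceil_lt_add_one (show 0 ≤ 2 / (tol / (16 * κ)) by positivity)).le.trans ?_
    have e : 2 / (tol / (16 * κ)) = 32 * κ / tol := by field_simp; norm_num
    rw [e, div_add_one htol.ne']
    gcongr
    linarith
  obtain ⟨d, gates, est, hd, hcnt, hest⟩ := exists_amplitude_estimation L m hL1 [i]
    (fun d inv ctl => (Gate.rotBasis i k inv ctl : Gate N K d))
  refine ⟨d, gates, est, 2 * d + 1, ?_, fun cnt p q h1 h2 h3 h4 => ?_, ?_⟩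
  · have h1 : ((2 * d + 1 : ℕ) : ℝ) ≤ 2 * ((m + 1) * L) := by
      have : 2 * d + 1 ≤ 2 * ((m + 1) * L) := by rw [← hd]; omega
      exact_mod_cast this
    refine h1.trans ?_
    have hlog : 0 ≤ Real.log x := Real.log_nonneg (by linarith)
    calc 2 * (((m : ℝ) + 1) * L) ≤ 2 * ((8 * Real.log x) * (33 * κ / tol)) := by gcongr
      _ = _ := by ring
  · rw [hcnt cnt p q h1 h2 h3 h4]; simp
  · intro O hinit hφ hφ01
    obtain ⟨htot, htail⟩ := hest O (O.basisFun i k) hinit hφ hφ01 fun _ _ _ _ => rfl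
    exact ⟨htot, ((htail _ hη).trans (window_failure_le hL2)).trans hm1⟩

/-! ### The pricing problem -/

theorem HasMargDensity.nullSingletonClass {N : ℕ} {μ : Measure (Fin N → ℝ)} {i : Fin N} {f : ℝ → ℝ}
    (hf : HasMargDensity μ i f) : NullSingletonClass (μ.map fun x => x i) := by
  rw [hf.law]; infer_instance

theorem margCDF_eq_cdf {N : ℕ} (μ : Measure (Fin N → ℝ)) [IsProbabilityMeasure μ] (i : Fin N)
    (t : ℝ) : margCDF μ i t = cdf (μ.map fun x => x i) t := by
  have : IsProbabilityMeasure (μ.map fun x => x i) :=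
    Measure.isProbabilityMeasure_map (measurable_pi_apply i).aemeasurable
  rw [cdf_eq_real, map_measureReal_apply (measurable_pi_apply i) measurableSet_Iic]
  rfl

/-- If the rebuilt distribution functions put the copula density within `ε / 2` of its true value,
estimating the payoff amplitude up to `ε / (2 c_max)` prices the option up to `ε`. -/
theorem le_prob_price {N : ℕ} {K : Fin N → ℕ} {a b : Fin N → ℝ} (hab : ∀ i, a i < b i)
    {c h : (Fin N → ℝ) → ℝ} {cmax ε : ℝ} (hcmax : 0 < cmax) {μ : Measure (Fin N → ℝ)}
    [IsProbabilityMeasure μ] {f : Fin N → ℝ → ℝ} (A : Loaders N f)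
    (hc : IsCopulaDensity c) (hcont : ContinuousOn c (Set.Icc 0 1))
    (hgr : IsGreatest (c '' Set.Icc 0 1) cmax) (hh : Measurable h)
    (hh01 : ∀ x, h x ∈ Set.Icc (0 : ℝ) 1) (hμ : IsCopulaOf c μ)
    (hf : ∀ i, HasMargDensity μ i (f i)) (i₀ : Fin N) (coef : ∀ i, Fin (K i) → ℝ)
    (hclose : ∀ x : Fin N → ℝ, |c (fun i => cosCDF (a i) (b i) (coef i) (x i))
      - c (fun i => margCDF μ i (x i))| ≤ ε / 2) {P : Algorithm N K} {q : ℝ}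
    (hP : ∀ (O : OracleSet N K) (p : ℝ), ‖O.init‖ = 1 → Measurable (O.payoffFun coef) →
        (∀ x, O.payoffFun coef x ∈ Set.Icc (0 : ℝ) 1) → p ∈ Set.Icc (0 : ℝ) 1 →
        p = ‖mulFun (fun x => √(O.payoffFun coef x))
          (loadAll O.load (List.finRange N) O.init)‖ ^ 2 →
        q ≤ P.prob O {y | |y - cmax * p| ≤ cmax * (ε / (2 * cmax))}) :
    q ≤ P.prob (pricingOracles A a b h c cmax) {y | |y - ∫ x, h x ∂μ| ≤ ε} := by
  have hprob : ∀ i, IsProbabilityMeasure (μ.map fun x => x i) := fun i =>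
    Measure.isProbabilityMeasure_map (measurable_pi_apply i).aemeasurable
  have hnull := fun i => (hf i).nullSingletonClass
  have hm := measurable_adjustedPayoff hab (cmax := cmax) hcont hh coef
  have h01 := adjustedPayoff_mem_Icc (a := a) (b := b) hcmax hc hgr hh01 coef
  have hp := norm_sq_loaded_all hf A (adjustedPayoff a b h c cmax coef) hm h01
  set π := Measure.pi fun i => μ.map fun x => x i with hπ
  set p := ∫ x, adjustedPayoff a b h c cmax coef x ∂π with hpdef
  have hp01 : p ∈ Set.Icc (0 : ℝ) 1 := by
    constructor
    · exact integral_nonneg fun x => (h01 x).1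
    · have hi : Integrable (adjustedPayoff a b h c cmax coef) π :=
        Integrable.of_bound hm.aestronglyMeasurable 1 (Eventually.of_forall fun x => by
          rw [Real.norm_eq_abs, abs_of_nonneg (h01 x).1]; exact (h01 x).2)
      calc p ≤ ∫ _, (1 : ℝ) ∂π := integral_mono hi (integrable_const _) fun x => (h01 x).2
        _ = 1 := by simp
  have hdist := abs_cmax_mul_integral_adjustedPayoff_sub_le hab hcmax hc hcont hgr hh hh01 hμ i₀
    (fun i => μ.map fun x => x i) (fun i t => margCDF_eq_cdf μ i t) coef hclose
  refine (hP (pricingOracles A a b h c cmax) p (norm_tensor _ fun i => norm_initial_state hf A i)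
    hm h01 hp01 hp.symm).trans (Algorithm.prob_mono _ (fun y hy => ?_) P)
  rw [Set.mem_ofPred_eq] at hy ⊢
  have e : cmax * (ε / (2 * cmax)) = ε / 2 := by field_simp
  rw [e] at hy
  calc |y - ∫ x, h x ∂μ| = |(y - cmax * p) + (cmax * p - ∫ x, h x ∂μ)| := by ring_nf
    _ ≤ |y - cmax * p| + |cmax * p - ∫ x, h x ∂μ| := abs_add_le _ _
    _ ≤ ε / 2 + ε / 2 := add_le_add hy hdist
    _ = ε := by ring

theorem PartialsBounded.abs_sub_le_of_forall {N : ℕ} {c : (Fin N → ℝ) → ℝ} {B t : ℝ} (hB : 0 ≤ B)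
    (hc : PartialsBounded c B) {u v : Fin N → ℝ} (hu : u ∈ Set.Icc (0 : Fin N → ℝ) 1)
    (hv : v ∈ Set.Icc (0 : Fin N → ℝ) 1) (h : ∀ i, |u i - v i| ≤ t) :
    |c u - c v| ≤ B * (N * t) := by
  refine (hc.abs_sub_le hu hv).trans (mul_le_mul_of_nonneg_left ?_ hB)
  calc ∑ i, |u i - v i| ≤ ∑ _i : Fin N, t := Finset.sum_le_sum fun i _ => h i
    _ = N * t := by simp

end

theorem mainTheorem2 (ℓ : ℝ) (hℓ : 0 < ℓ) :
    ∃ C : ℝ, 0 < C ∧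
      ∀ (N : ℕ) (ε ρ cd cmax : ℝ) (a b : Fin N → ℝ) (r : Fin N → CosRate),
        1 ≤ N → ε ∈ Set.Ioo (0 : ℝ) 1 → ρ ∈ Set.Ioo (0 : ℝ) 1 → 0 ≤ cd → 0 < cmax →
        (∀ i, a i < b i) → (∀ i, (r i).Valid) → ℓ ≤ maxLength a b →
        ∃ P : Algorithm N (numTerms ε cd a b r),
          (P.basisQueries : ℝ) ≤
              C * (N ^ 2 * cd * √(maxLength a b) * maxTerms (numTerms ε cd a b r) ^ 2 / ε
                * Real.log (N * maxTerms (numTerms ε cd a b r) / ρ)) ∧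
          (P.payoffQueries : ℝ) ≤ C * (cmax / ε * Real.log (1 / ρ)) ∧
          (P.loadQueries : ℝ) ≤
              C * (N ^ 2 * cd * maxLength a b * maxTerms (numTerms ε cd a b r) ^ 2 / ε
                  * Real.log (N * maxTerms (numTerms ε cd a b r) / ρ)
                + N * cmax / ε * Real.log (1 / ρ)) ∧
          ∀ (c h : (Fin N → ℝ) → ℝ) (μ : MeasureTheory.Measure (Fin N → ℝ))
            (f : Fin N → ℝ → ℝ) (A : Loaders N f),
            IsCopulaDensity c →
            PartialsBounded c cd →
            IsGreatest (c '' Set.Icc 0 1) cmax →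
            Measurable h →
            (∀ x, h x ∈ Set.Icc (0 : ℝ) 1) →
            MeasureTheory.IsProbabilityMeasure μ →
            IsCopulaOf c μ →
            (∀ i, HasMargDensity μ i (f i)) →
            (∀ i, HasCosRate (a i) (b i) (f i) (r i)) →
            (0 < cd → ∀ i, margCDF μ i (a i) ≤ margTol N ε cd / 2 ∧
              1 - margTol N ε cd ≤ margCDF μ i (b i)) →
            1 - ρ ≤ P.prob (pricingOracles A a b h c cmax)
              {y | |y - ∫ x, h x ∂μ| ≤ ε} := by
  refine ⟨1056 / √ℓ + 1056 / ℓ + 120, by positivity, ?_⟩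
  intro N ε ρ cd cmax a b r hN hε hρ hcd hcmax hab hr hlen
  set K := numTerms ε cd a b r with hK
  set κ : ℝ := ((maxTerms K : ℕ) : ℝ) with hκ
  set I := maxLength a b with hI
  have i₀ : Fin N := ⟨0, hN⟩
  have hKκ : ∀ i, K i ≤ maxTerms K := fun i => Finset.le_sup (f := K) (Finset.mem_univ i)
  have hκ1 : 1 ≤ κ := by
    have : 1 ≤ maxTerms K := (CosRate.one_le_terms _ _ _).trans (hKκ i₀)
    rw [hκ]; exact_mod_cast this
  have hN1 : (1 : ℝ) ≤ N := by exact_mod_cast hN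
  have hNpos : (0 : ℝ) < N := by linarith
  have hρ0 := hρ.1
  have hε0 := hε.1
  have hIpos : 0 < I := hℓ.trans_le hlen
  have hx1 : 1 ≤ N * κ / ρ := by
    rw [le_div_iff₀ hρ0, one_mul]; nlinarith [hρ.2]
  have hlog1 : 0 ≤ Real.log (N * κ / ρ) := Real.log_nonneg hx1
  have hlog2 : 0 ≤ Real.log (1 / ρ) := Real.log_nonneg ((one_le_div hρ0).2 hρ.2.le)
  obtain ⟨g, m, hg, hgm, hsucc⟩ := exists_guess_window hcmax hε0 hρ
  set q : ℝ := (1 - ((m : ℝ) + 1) / 4 ^ m) * (1 / g) with hq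
  have hq0 : 0 ≤ q := by
    have h1 : 0 < 1 - ρ / 4 := by linarith [hρ.2]
    exact (pos_of_mul_pos_right (lt_of_lt_of_le (by linarith [hρ.2]) hsucc) h1.le).le
  have hqρ : 1 - ρ ≤ q := hsucc.trans (mul_le_of_le_one_left hq0 (by linarith))
  choose F hFb hFp hFl hFc using fun coef : ∀ i, Fin (K i) → ℝ =>
    exists_payoff_estimation coef g m hg (δ := ε / (2 * cmax)) (M := cmax) (by positivity) hcmax.le
  set T : ℝ := 120 * (cmax / ε * Real.log (1 / ρ)) with hT
  have hTC : T ≤ (1056 / √ℓ + 1056 / ℓ + 120) * (cmax / ε * Real.log (1 / ρ)) := by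
    rw [hT]
    refine mul_le_mul_of_nonneg_right ?_ (by positivity)
    have : 0 ≤ 1056 / √ℓ + 1056 / ℓ := by positivity
    linarith
  have hNT : N * T ≤ (1056 / √ℓ + 1056 / ℓ + 120) * (N * cmax / ε * Real.log (1 / ρ)) := by
    calc N * T ≤ N * ((1056 / √ℓ + 1056 / ℓ + 120) * (cmax / ε * Real.log (1 / ρ))) := by gcongr
      _ = _ := by ring
  by_cases hskip : N = 1 ∨ 2 * N * cd ≤ ε
  -- Rough distribution functions already determine the copula density up to `ε / 2`.
  · refine ⟨F fun _ _ => 0, ?_, ((hFp _).trans hgm).trans hTC, ?_, ?_⟩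
    · rw [hFb]; push_cast; positivity
    · refine ((hFl _).trans (mul_le_mul_of_nonneg_left hgm hNpos.le)).trans (hNT.trans ?_)
      gcongr
      exact le_add_of_nonneg_left (by positivity)
    · intro c h μ f A hc hpart hgr hh hh01 hprob hμ hf _ _
      refine hqρ.trans (le_prob_price hab hcmax A hc hpart.continuousOn hgr hh hh01 hμ hf i₀ _ ?_
        (hFc _))
      intro x
      have hu : (fun i => cosCDF (a i) (b i) (fun _ : Fin (K i) => (0 : ℝ)) (x i))
          ∈ Set.Icc (0 : Fin N → ℝ) 1 :=
        ⟨fun i => (cosCDF_mem_Icc _ _ _ _).1, fun i => (cosCDF_mem_Icc _ _ _ _).2⟩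
      have hv : (fun i => margCDF μ i (x i)) ∈ Set.Icc (0 : Fin N → ℝ) 1 :=
        ⟨fun i => measureReal_nonneg, fun i => measureReal_le_one⟩
      rcases hskip with h1 | h1
      · subst h1
        rw [hc.eq_one_of_fin_one hpart.continuousOn hu,
          hc.eq_one_of_fin_one hpart.continuousOn hv, sub_self, abs_zero]
        positivity
      · refine (hpart.abs_sub_le_of_forall (t := 1) hcd hu hv fun i => ?_).trans (by linarith)
        have hui := cosCDF_mem_Icc (a i) (b i) (fun _ : Fin (K i) => (0 : ℝ)) (x i)
        have hv0 : 0 ≤ margCDF μ i (x i) := hv.1 i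
        have hv1 : margCDF μ i (x i) ≤ 1 := hv.2 i
        rw [abs_le]
        constructor <;> linarith [hui.1, hui.2]
  · push Not at hskip
    obtain ⟨hN2, hNcd⟩ := hskip
    have hN2' : (2 : ℝ) ≤ N := by exact_mod_cast (show 2 ≤ N by omega)
    have hcdpos : 0 < cd := by
      rcases hcd.eq_or_lt with h | h
      · rw [← h] at hNcd; linarith
      · exact h
    set tol := margTol N ε cd with htoldef
    have htol : 0 < tol := by rw [htoldef, margTol]; positivity
    have htol1 : tol ≤ 1 := by
      rw [htoldef, margTol, div_le_one (by positivity)]; exact hNcd.le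
    have hx2 : 2 ≤ N * κ / ρ := by
      rw [le_div_iff₀ hρ0]; nlinarith [hρ.2]
    choose d gates est s hs hscnt hsc using fun p : Σ i, Fin (K i) =>
      exists_coefficient_estimation (K := K) p.1 p.2 htol htol1 hκ1 hx2
    -- Each coefficient is allowed to fail with probability `ρ / (4 N κ)`, all of them with `ρ / 4`.
    set l : List (Σ i, Fin (K i)) := Finset.univ.toList with hl
    have hlen_l : (l.length : ℝ) ≤ N * κ := by
      have h1 : l.length ≤ N * maxTerms K := by
        rw [hl, Finset.length_toList, Finset.card_univ, Fintype.card_sigma]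
        calc ∑ i, Fintype.card (Fin (K i)) ≤ ∑ _i : Fin N, maxTerms K :=
              Finset.sum_le_sum fun i _ => by rw [Fintype.card_fin]; exact hKκ i
          _ = N * maxTerms K := by simp
      rw [hκ]; exact_mod_cast h1
    set s₀ := Finset.univ.sup s with hs₀
    have hs₀le : (s₀ : ℝ) ≤ 528 * Real.log (N * κ / ρ) * κ / tol := by
      have hne : (Finset.univ : Finset (Σ i, Fin (K i))).Nonempty :=
        ⟨⟨i₀, ⟨0, CosRate.one_le_terms _ _ _⟩⟩, Finset.mem_univ _⟩
      obtain ⟨p, -, hp⟩ := Finset.exists_mem_eq_sup _ hne s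
      rw [hs₀, hp]; exact hs p
    have hls : (l.length : ℝ) * s₀
        ≤ 1056 * (N ^ 2 * cd * κ ^ 2 / ε * Real.log (N * κ / ρ)) := by
      calc (l.length : ℝ) * s₀ ≤ (N * κ) * (528 * Real.log (N * κ / ρ) * κ / tol) := by gcongr
        _ = _ := by rw [htoldef, margTol]; field_simp; ring
    have hX : 0 ≤ N ^ 2 * cd * κ ^ 2 / ε * Real.log (N * κ / ρ) := by positivity
    set coefOf : ((Σ i, Fin (K i)) → ℝ) → ∀ i, Fin (K i) → ℝ :=
      fun v i k => √(2 / (b i - a i)) * (2 * v ⟨i, k⟩ - 1) with hcoefOf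
    refine ⟨estimateAll gates est (fun v => F (coefOf v)) l fun _ => 0, ?_, ?_, ?_, ?_⟩
    · have h1 : (estimateAll gates est (fun v => F (coefOf v)) l fun _ => 0).basisQueries
          ≤ l.length * s₀ + 0 := by
        refine count_estimateAll_le gates est _ _ (fun p => ?_) (fun v => (hFb _).le) l _
        rw [hscnt p _ 0 1 (fun _ => rfl) (fun _ => rfl) (fun _ _ _ => rfl) fun _ _ => rfl,
          zero_add, mul_one]
        exact Finset.le_sup (f := s) (Finset.mem_univ p)
      have h2 : ((estimateAll gates est (fun v => F (coefOf v)) l fun _ => 0).basisQueries : ℝ)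
          ≤ l.length * s₀ := by exact_mod_cast h1
      refine (h2.trans hls).trans ?_
      have h3 : 1 ≤ √I / √ℓ := by
        rw [one_le_div (by positivity)]; exact Real.sqrt_le_sqrt hlen
      calc 1056 * (N ^ 2 * cd * κ ^ 2 / ε * Real.log (N * κ / ρ))
          ≤ 1056 * (N ^ 2 * cd * κ ^ 2 / ε * Real.log (N * κ / ρ)) * (√I / √ℓ) :=
            le_mul_of_one_le_right (by positivity) h3
        _ = 1056 / √ℓ * (N ^ 2 * cd * √I * κ ^ 2 / ε * Real.log (N * κ / ρ)) := by ring
        _ ≤ _ := by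
          refine mul_le_mul_of_nonneg_right ?_ (by positivity)
          rw [add_assoc]
          exact le_add_of_nonneg_right (by positivity)
    · set n := ⌊T⌋₊ with hn
      have h1 : (estimateAll gates est (fun v => F (coefOf v)) l fun _ => 0).payoffQueries
          ≤ l.length * 0 + n := by
        refine count_estimateAll_le gates est _ _ (fun p => ?_)
          (fun v => Nat.le_floor ((hFp _).trans hgm)) l _
        rw [hscnt p _ 0 0 (fun _ => rfl) (fun _ => rfl) (fun _ _ _ => rfl) fun _ _ => rfl]
        simp
      rw [mul_zero, zero_add] at h1
      exact ((Nat.cast_le.2 h1).trans (Nat.floor_le (by positivity))).trans hTC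
    · set n := ⌊N * T⌋₊ with hn
      have h1 : (estimateAll gates est (fun v => F (coefOf v)) l fun _ => 0).loadQueries
          ≤ l.length * s₀ + n := by
        refine count_estimateAll_le gates est _ _ (fun p => ?_)
          (fun v => Nat.le_floor ((hFl _).trans (mul_le_mul_of_nonneg_left hgm hNpos.le))) l _
        rw [hscnt p _ 1 0 (fun _ => rfl) (fun _ => rfl) (fun _ _ _ => rfl) fun _ _ => rfl,
          add_zero, mul_one]
        exact Finset.le_sup (f := s) (Finset.mem_univ p)
      have h2 : ((estimateAll gates est (fun v => F (coefOf v)) l fun _ => 0).loadQueries : ℝ)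
          ≤ l.length * s₀ + N * T := by
        refine (Nat.cast_le.2 h1).trans ?_
        push_cast
        have : (n : ℝ) ≤ N * T := Nat.floor_le (by positivity)
        linarith
      refine h2.trans ?_
      rw [mul_add]
      refine add_le_add (hls.trans ?_) hNT
      have h3 : 1 ≤ I / ℓ := by rw [one_le_div hℓ]; exact hlen
      calc 1056 * (N ^ 2 * cd * κ ^ 2 / ε * Real.log (N * κ / ρ))
          ≤ 1056 * (N ^ 2 * cd * κ ^ 2 / ε * Real.log (N * κ / ρ)) * (I / ℓ) :=
            le_mul_of_one_le_right (by positivity) h3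
        _ = 1056 / ℓ * (N ^ 2 * cd * I * κ ^ 2 / ε * Real.log (N * κ / ρ)) := by ring
        _ ≤ _ := by
          refine mul_le_mul_of_nonneg_right ?_ (by positivity)
          have : 0 ≤ 1056 / √ℓ := by positivity
          linarith
    · intro c h μ f A hc hpart hgr hh hh01 hprob hμ hf hrate hmarg
      have hprob' : ∀ i, IsProbabilityMeasure (μ.map fun x => x i) := fun i =>
        Measure.isProbabilityMeasure_map (measurable_pi_apply i).aemeasurable
      set O : OracleSet N K := pricingOracles A a b h c cmax with hO
      have hinit : ‖O.init‖ = 1 := norm_tensor _ fun i => norm_initial_state hf A i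
      have hfail1 : 1 / (4 * (N * κ / ρ)) ≤ 1 := by
        rw [div_le_one (by positivity)]; linarith
      have hmain := le_prob_estimateAll gates est (fun v => F (coefOf v)) O
        {y | |y - ∫ x, h x ∂μ| ≤ ε}
        (fun p e => |e - ∫ x, cosBasisPos (a p.1) (b p.1) p.2 x ∂(μ.map fun x => x p.1)|
          ≤ tol / (16 * κ)) hq0 hfail1 ?_ ?_ ?_ l (fun _ => 0)
          (fun p hp => absurd (Finset.mem_toList.2 (Finset.mem_univ p)) hp)
      · refine hsucc.trans (le_trans (mul_le_mul_of_nonneg_right ?_ hq0) hmain)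
        have hB := one_add_mul_le_pow (a := -(1 / (4 * (N * κ / ρ)))) (by linarith) l.length
        rw [← sub_eq_add_neg] at hB
        refine le_trans ?_ hB
        have : (l.length : ℝ) * (1 / (4 * (N * κ / ρ))) ≤ ρ / 4 := by
          calc (l.length : ℝ) * (1 / (4 * (N * κ / ρ))) ≤ (N * κ) * (1 / (4 * (N * κ / ρ))) := by
                gcongr
            _ = ρ / 4 := by field_simp
        linarith
      · intro p
        exact (hsc p O hinit ((measurable_cosBasisPos _ _ _).comp (measurable_pi_apply _))
          fun x => cosBasisPos_mem_Icc (hab _) _ _).1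
      · intro p
        have h1 := (hsc p O hinit ((measurable_cosBasisPos _ _ _).comp (measurable_pi_apply _))
          fun x => cosBasisPos_mem_Icc (hab _) _ _).2
        have h2 := norm_sq_loaded_one hf A p.1 (cosBasisPos (a p.1) (b p.1) p.2)
          (measurable_cosBasisPos _ _ _) (cosBasisPos_mem_Icc (hab _) _)
        have h3 : ‖mulFun (fun x => √(O.basisFun p.1 p.2 x)) (loadAll O.load [p.1] O.init)‖ ^ 2
            = ∫ x, cosBasisPos (a p.1) (b p.1) p.2 x ∂(μ.map fun x => x p.1) := h2
        rw [h3] at h1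
        simp only [not_le]
        convert h1
      · intro v hv
        refine le_prob_price hab hcmax A hc hpart.continuousOn hgr hh hh01 hμ hf i₀ _ ?_ (hFc _)
        intro x
        have hu : (fun i => cosCDF (a i) (b i) (coefOf v i) (x i)) ∈ Set.Icc (0 : Fin N → ℝ) 1 :=
          ⟨fun i => (cosCDF_mem_Icc _ _ _ _).1, fun i => (cosCDF_mem_Icc _ _ _ _).2⟩
        have hv' : (fun i => margCDF μ i (x i)) ∈ Set.Icc (0 : Fin N → ℝ) 1 :=
          ⟨fun i => measureReal_nonneg, fun i => measureReal_le_one⟩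
        refine (hpart.abs_sub_le_of_forall (t := tol) hcd hu hv' fun i => ?_).trans (le_of_eq ?_)
        · have h1 := hmarg hcdpos i
          simp only [margCDF_eq_cdf] at h1 ⊢
          refine abs_cosCDF_sub_cdf_le (hf i).measurable (hf i).nonneg (hf i).law (hab i) htol
            (hrate i (K i) (CosRate.one_le_terms _ _ _))
            (CosRate.bound_terms_le (hr i) (sub_pos.2 (hab i)) htol) h1.1 h1.2
            (fun k => v ⟨i, k⟩) (fun k => hv ⟨i, k⟩) ?_ (x i)
          have hKi : (K i : ℝ) ≤ κ := by rw [hκ]; exact_mod_cast hKκ i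
          have hκpos : 0 < κ := by linarith
          calc 4 * (K i * (tol / (16 * κ))) ≤ 4 * (κ * (tol / (16 * κ))) := by gcongr
            _ = tol / 4 := by field_simp; norm_num
        · rw [htoldef, margTol]; field_simp
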